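/- \textbf{Setting.} All systems are finite-dimensional and carry a fixed (incoherent) basis. A state is incoherent if its density matrix is diagonal in that basis. A family of Kraus operators $K_n$ (finitely many, possibly between different systems) is incoherent if $\sum_n K_n^\dagger K_n=\mathbb 1$ and $K_n\delta K_n^\dagger$ is diagonal for every incoherent state $\delta$ and every $n$; an ICPTP map is a map of the form $\Phi(\rho)=\sum_n K_n\rho K_n^\dagger$ with such a family. A coherence measure is an assignment $\rho\mapsto\mathcal C(\rho)\in\mathbb R$ on the states of all such systems satisfying (C1) $\mathcal C(\rho)\ge 0$, with equality if and only if $\rho$ is incoherent; (C2a) $\mathcal C(\Phi(\rho))\le\mathcal C(\rho)$ for every ICPTP map $\Phi$; (C2b) $\sum_n p_n\,\mathcal C(\rho_n)\le\mathcal C(\rho)$ for every incoherent Kraus family, where $p_n=\mathrm{Tr}[K_n\rho K_n^\dagger]$ and $\rho_n=K_n\rho K_n^\dagger/p_n$ (outcomes with $p_n=0$ are omitted); (C3) $\mathcal C(\lambda\rho+(1-\lambda)\sigma)\le\lambda\,\mathcal C(\rho)+(1-\lambda)\,\mathcal C(\sigma)$ for $0\le\lambda\le1$. The quantum Fisher information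 of a state with eigenvalues $\lambda_i$ and eigenvectors $|i\rangle$ is $\mathcal F(\rho,H)=2\sum_{\lambda_i+\lambda_j>0}\frac{(\lambda_i-\lambda_j)^2}{\lambda_i+\lambda_j}|\langle i|H|j\rangle|^2$. \textbf{The quantity.} Let $M,N\ge1$. For $1\le i\le M$, $1\le k\le N$ let particle $(i,k)$ be a finite-dimensional system with a fixed incoherent basis, let $h^{(i,k)}$ be a Hermitian operator on it which is diagonal in this basis and not proportional to the identity, let $|g^{(i,k)}\rangle\ne|e^{(i,k)}\rangle$ be two vectors of this basis, and set $D_+^{(i,k)}=|e^{(i,k)}\rangle\langle g^{(i,k)}|$, $D_-^{(i,k)}=|g^{(i,k)}\rangle\langle e^{(i,k)}|$. The $i$th collection $P(i)$ consists of the particles $(i,1),\dots,(i,N)$ and of ancillary particles of arbitrary finite total dimension with a fixed incoherent basis, on which $H_S^{(i)}=\sum_{k=1}^N h^{(i,k)}$ and the $D_\pm^{(i,k)}$ act trivially; collections carry the product basis. For a pure state $|\psi\rangle$ of any finite-dimensional system put $$\mathcal C_{SF}(|\psi\rangle)=\max_{\Phi}\ \sum_{i=1}^M\Big[\tfrac14\,\mathcal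 F\big(\mathrm{Tr}_{P(i)^c}[\Phi(|\psi\rangle\langle\psi|)],H_S^{(i)}\big)+\sum_{k\ne l}\mathrm{Tr}\big[\Phi(|\psi\rangle\langle\psi|)\,D_+^{(i,k)}D_-^{(i,l)}\big]\Big],$$ where the maximum is over all choices of the ancilla dimensions and all ICPTP maps $\Phi$ from the system of $|\psi\rangle$ to the joint system $P(1)\cdots P(M)$, and for a state $\rho$ put $$\mathcal C_{SF}(\rho)=\min_{\{p_m,|\psi_m\rangle\}}\ \sum_m p_m\,\mathcal C_{SF}(|\psi_m\rangle),$$ where the minimum is over all finite pure state decompositions $\rho=\sum_m p_m|\psi_m\rangle\langle\psi_m|$. \textbf{Theorem.} For all such $M$, $N$, $h^{(i,k)}$, $g^{(i,k)}$, $e^{(i,k)}$, the maximum and the minimum exist, and $\mathcal C_{SF}$ is a coherence measure. -/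

import Mathlib

open scoped Matrix Kronecker ComplexOrder

noncomputable section

namespace SFCoherence

/-! ### States, incoherent states and incoherent operations

A finite-dimensional system with a fixed incoherent basis is a finite type `ι` labelling that basis;
operators are complex matrices in that basis. -/

section Basic

variable {ι κ : Type} [Fintype ι] [Fintype κ] [DecidableEq ι] [DecidableEq κ]

/-- Density matrices. -/
def IsState (ρ : Matrix ι ι ℂ) : Prop := ρ.PosSemidef ∧ ρ.trace = 1

/-- Incoherent states: the diagonal density matrices. -/
def IsIncoherent (ρ : Matrix ι ι ℂ) : Prop := IsState ρ ∧ ρ.IsDiag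

/-- `ψ` is a unit vector. -/
def IsPure (ψ : ι → ℂ) : Prop := ∑ i, ‖ψ i‖ ^ 2 = 1

/-- The projector `|ψ⟩⟨ψ|`. -/
def proj (ψ : ι → ℂ) : Matrix ι ι ℂ := Matrix.vecMulVec ψ (star ψ)

/-- Incoherent Kraus families: `∑ₙ Kₙ† Kₙ = 1`, and each `Kₙ` maps incoherent states to
(unnormalized) incoherent states. -/
def IsIncoherentKraus {r : ℕ} (K : Fin r → Matrix κ ι ℂ) : Prop :=
  ∑ n, (K n)ᴴ * K n = 1 ∧ ∀ n, ∀ δ : Matrix ι ι ℂ, IsIncoherent δ → (K n * δ * (K n)ᴴ).IsDiag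

/-- Incoherent completely positive trace preserving maps (possibly between different systems):
the maps that possess an incoherent Kraus representation. -/
def IsICPTP (Φ : Matrix ι ι ℂ → Matrix κ κ ℂ) : Prop :=
  ∃ (r : ℕ) (K : Fin r → Matrix κ ι ℂ), IsIncoherentKraus K ∧
    ∀ ρ, Φ ρ = ∑ n, K n * ρ * (K n)ᴴ

/-- The probability of the outcome with Kraus operator `K`. -/
def outcomeProb (K : Matrix κ ι ℂ) (ρ : Matrix ι ι ℂ) : ℝ := (K * ρ * Kᴴ).trace.re

/-- The state after the outcome with Kraus operator `K` (relevant when it has nonzero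
probability). -/
def outcomeState (K : Matrix κ ι ℂ) (ρ : Matrix ι ι ℂ) : Matrix κ κ ℂ :=
  ((outcomeProb K ρ)⁻¹ : ℝ) • (K * ρ * Kᴴ)

/-- Quantum Fisher information `2 ∑ᵢⱼ (λᵢ - λⱼ)² / (λᵢ + λⱼ) |⟨i|H|j⟩|²`, where `λᵢ`, `|i⟩` are the
eigenvalues and eigenvectors of `ρ`. Terms with `λᵢ + λⱼ = 0` are omitted, as usual
(they vanish because `x / 0 = 0`). Only used for positive semidefinite `ρ`. -/
def qfi (ρ H : Matrix ι ι ℂ) : ℝ :=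
  open Classical in
  if hρ : ρ.IsHermitian then
    2 * ∑ i, ∑ j, (hρ.eigenvalues i - hρ.eigenvalues j) ^ 2 /
        (hρ.eigenvalues i + hρ.eigenvalues j) *
      ‖(star (hρ.eigenvectorUnitary : Matrix ι ι ℂ) * H *
        (hρ.eigenvectorUnitary : Matrix ι ι ℂ)) i j‖ ^ 2
  else 0

end Basic

/-- The axioms for a coherence measure. A measure assigns a number to each state of each
finite-dimensional system with a fixed incoherent basis. -/
structure IsCoherenceMeasure
    (C : ∀ (ι : Type) [Fintype ι] [DecidableEq ι], Matrix ι ι ℂ → ℝ) : Prop where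
  /-- (C1), nonnegativity. -/
  nonneg : ∀ (ι : Type) [Fintype ι] [DecidableEq ι] (ρ : Matrix ι ι ℂ), IsState ρ → 0 ≤ C ι ρ
  /-- (C1), faithfulness. -/
  eq_zero_iff : ∀ (ι : Type) [Fintype ι] [DecidableEq ι] (ρ : Matrix ι ι ℂ), IsState ρ →
    (C ι ρ = 0 ↔ IsIncoherent ρ)
  /-- (C2a), monotonicity. -/
  monotone : ∀ (ι κ : Type) [Fintype ι] [DecidableEq ι] [Fintype κ] [DecidableEq κ]
    (Φ : Matrix ι ι ℂ → Matrix κ κ ℂ), IsICPTP Φ →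
    ∀ ρ : Matrix ι ι ℂ, IsState ρ → C κ (Φ ρ) ≤ C ι ρ
  /-- (C2b), strong monotonicity (outcomes of probability zero contribute zero). -/
  strong_monotone : ∀ (ι κ : Type) [Fintype ι] [DecidableEq ι] [Fintype κ] [DecidableEq κ]
    (r : ℕ) (K : Fin r → Matrix κ ι ℂ), IsIncoherentKraus K →
    ∀ ρ : Matrix ι ι ℂ, IsState ρ →
      ∑ n, outcomeProb (K n) ρ * C κ (outcomeState (K n) ρ) ≤ C ι ρ
  /-- (C3), convexity. -/
  convex : ∀ (ι : Type) [Fintype ι] [DecidableEq ι] (ρ σ : Matrix ι ι ℂ),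
    IsState ρ → IsState σ → ∀ t : ℝ, 0 ≤ t → t ≤ 1 →
      C ι (t • ρ + (1 - t) • σ) ≤ t * C ι ρ + (1 - t) * C ι σ

/-! ### Composite systems -/

section Composite

variable {I : Type} [Fintype I] [DecidableEq I] {τ : I → Type} [∀ i, Fintype (τ i)]
  [∀ i, DecidableEq (τ i)]

/-- The operator on the tensor product of the systems `τ j` that acts as `B` on the factor `i` and
as the identity on all other factors. -/
def onFactor (i : I) (B : Matrix (τ i) (τ i) ℂ) : Matrix (∀ j, τ j) (∀ j, τ j) ℂ :=
  Matrix.of fun x y => if ∀ j, j ≠ i → x j = y j then B (x i) (y i) else 0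

/-- The partial trace over every factor except `i`. -/
def reduceTo (i : I) (ρ : Matrix (∀ j, τ j) (∀ j, τ j) ℂ) : Matrix (τ i) (τ i) ℂ :=
  Matrix.of fun a b => ∑ z : ∀ j, τ j, if z i = a then ρ z (Function.update z i b) else 0

end Composite

/-! ### The joint quantity -/

/-- The data of the joint superradiance / Fisher information task: `M` collections of `N` particles.
Particle `(i, k)` has a fixed incoherent basis, labelled by `Fin (dim i k)`; it carries a Hermitian
single-particle Hamiltonian `h i k`, diagonal in that basis and not proportional to the identity,
and an addressed transition between two distinct basis states `g i k` (ground) and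
`e i k` (excited). -/
structure Setup (M N : ℕ) where
  dim : Fin M → Fin N → ℕ
  h : ∀ i k, Matrix (Fin (dim i k)) (Fin (dim i k)) ℂ
  h_isHermitian : ∀ i k, (h i k).IsHermitian
  h_isDiag : ∀ i k, (h i k).IsDiag
  h_nontrivial : ∀ i k, ∀ c : ℂ, h i k ≠ c • 1
  g : ∀ i k, Fin (dim i k)
  e : ∀ i k, Fin (dim i k)
  g_ne_e : ∀ i k, g i k ≠ e i k

namespace Setup

variable {M N : ℕ} (S : Setup M N)

/-- Basis labels of the `i`th collection: its `N` particles that take part in the task, together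
with ancillary particles of total dimension `a i`, on which the task acts trivially. -/
abbrev Cell (a : Fin M → ℕ) (i : Fin M) : Type := (∀ k : Fin N, Fin (S.dim i k)) × Fin (a i)

/-- Basis labels of the whole output system, the tensor product of the `M` collections. -/
abbrev Out (a : Fin M → ℕ) : Type := ∀ i : Fin M, S.Cell a i

/-- A single-particle operator on particle `k` of collection `i`, acting on that collection. -/
def onParticle (a : Fin M → ℕ) (i : Fin M) (k : Fin N)
    (A : Matrix (Fin (S.dim i k)) (Fin (S.dim i k)) ℂ) :
    Matrix (S.Cell a i) (S.Cell a i) ℂ :=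
  onFactor (τ := fun k => Fin (S.dim i k)) k A ⊗ₖ (1 : Matrix (Fin (a i)) (Fin (a i)) ℂ)

/-- The local signal Hamiltonian `∑ₖ h^(i,k)` of collection `i`. -/
def signal (a : Fin M → ℕ) (i : Fin M) : Matrix (S.Cell a i) (S.Cell a i) ℂ :=
  ∑ k, S.onParticle a i k (S.h i k)

/-- The raising operator `|e⟩⟨g|` of particle `(i, k)`. -/
def raising (a : Fin M → ℕ) (i : Fin M) (k : Fin N) : Matrix (S.Out a) (S.Out a) ℂ :=
  onFactor (τ := S.Cell a) i (S.onParticle a i k (Matrix.single (S.e i k) (S.g i k) 1))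

/-- The lowering operator `|g⟩⟨e|` of particle `(i, k)`. -/
def lowering (a : Fin M → ℕ) (i : Fin M) (k : Fin N) : Matrix (S.Out a) (S.Out a) ℂ :=
  onFactor (τ := S.Cell a) i (S.onParticle a i k (Matrix.single (S.g i k) (S.e i k) 1))

/-- The superradiant quantity `∑_{k ≠ l} Tr[σ D₊^(i,k) D₋^(i,l)]` of collection `i` (real, since the
operator `∑_{k ≠ l} D₊^(i,k) D₋^(i,l)` is Hermitian). -/
def superradiance (a : Fin M → ℕ) (i : Fin M) (σ : Matrix (S.Out a) (S.Out a) ℂ) : ℝ :=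
  (∑ k, ∑ l, if k ≠ l then (σ * S.raising a i k * S.lowering a i l).trace else 0).re

/-- The sum over the collections of one quarter of the quantum Fisher information and the
superradiant quantity. -/
def objective (a : Fin M → ℕ) (σ : Matrix (S.Out a) (S.Out a) ℂ) : ℝ :=
  ∑ i, ((1 / 4 : ℝ) * qfi (reduceTo (τ := S.Cell a) i σ) (S.signal a i) + S.superradiance a i σ)

variable {ι : Type} [Fintype ι] [DecidableEq ι]

/-- The values of the objective that incoherent operations can reach from `|ψ⟩`. The operation may
output any finite number of ancillary dimensions in each collection. -/
def pureValues (ψ : ι → ℂ) : Set ℝ :=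
  {v | ∃ (a : Fin M → ℕ) (Φ : Matrix ι ι ℂ → Matrix (S.Out a) (S.Out a) ℂ),
    IsICPTP Φ ∧ v = S.objective a (Φ (proj ψ))}

/-- The joint quantity of a pure state. -/
def pureCSF (ψ : ι → ℂ) : ℝ := sSup (S.pureValues ψ)

/-- The averages of the joint quantity over the pure state decompositions of `ρ`. -/
def roofValues (ρ : Matrix ι ι ℂ) : Set ℝ :=
  {v | ∃ (r : ℕ) (p : Fin r → ℝ) (ψ : Fin r → ι → ℂ),
    (∀ m, 0 ≤ p m) ∧ ∑ m, p m = 1 ∧ (∀ m, IsPure (ψ m)) ∧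
    ρ = ∑ m, p m • proj (ψ m) ∧ v = ∑ m, p m * S.pureCSF (ψ m)}

/-- The joint quantity of a mixed state, its convex roof. -/
def CSF (ρ : Matrix ι ι ℂ) : ℝ := sInf (S.roofValues ρ)

end Setup

end SFCoherence

end

/-!
The quantum Fisher information of `ρ` is the largest value over `A` of a functional which is linear
in `ρ` and whose maximizer is bounded in terms of `H` alone. It is therefore convex, homogeneous and
continuous, and it adds up over branches that are marked by orthogonal flags in an ancilla.

An incoherent Kraus operator has at most one nonzero entry in each column. It moves basis vectors
and multiplies them by coefficients, so up to renaming the ancilla levels there are only finitely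
many patterns of moves, and an operation is a convex combination of pairs (pattern, unit vector of
coefficients) whose effects average to a multiple of the identity. By Carathéodory's theorem
boundedly many pairs suffice, and the maximum is that of a continuous function on a compact set. The
same principle gives continuity of the maximum and the existence of the optimal pure state
decomposition.

Strong monotonicity on pure states holds because an optimal operation may be applied after each
outcome while the outcome is kept as a flag. A coherent pure state has two basis labels with nonzero
amplitude. Storing all labels in an ancilla, and separating these two by nothing but the energy of
one particle, produces a state that does not commute with the Hamiltonian and has no superradiant
term.
-/

noncomputable section

namespace SFCoherence

/-! ### Convex decompositions -/

section Decompositions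

variable {X Y E : Type*} [AddCommGroup E] [Module ℝ E]

/-- The decompositions `p = ∑ₘ wₘ g(xₘ)` of a point into a convex combination of `r` points `g(xₘ)`
with `xₘ` in `s`. Incoherent operations and pure state decompositions both take this form. -/
def decompositions (s : Set X) (g : X → E) (p : E) (r : ℕ) : Set ((Fin r → ℝ) × (Fin r → X)) :=
  {q | (∀ m, 0 ≤ q.1 m) ∧ ∑ m, q.1 m = 1 ∧ (∀ m, q.2 m ∈ s) ∧ p = ∑ m, q.1 m • g (q.2 m)}

/-- The average of `f` over a decomposition. -/
def average (f : X → ℝ) {r : ℕ} (q : (Fin r → ℝ) × (Fin r → X)) : ℝ := ∑ m, q.1 m * f (q.2 m)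

/-- The averages of `f` over all decompositions of `p`, of any length. Their infimum as a function
of `p` is the convex roof of `f`. -/
def decompositionValues (s : Set X) (g : X → E) (f : X → ℝ) (p : E) : Set ℝ :=
  {v | ∃ r, ∃ q ∈ decompositions s g p r, v = average f q}

theorem mem_convexHull_of_mem_decompositions {s : Set X} {g : X → E} {p : E} {r : ℕ}
    {q : (Fin r → ℝ) × (Fin r → X)} (hq : q ∈ decompositions s g p r) (f : X → ℝ) :
    (p, average f q) ∈ convexHull ℝ ((fun x => (g x, f x)) '' s) := by
  obtain ⟨hw, hw1, hx, rfl⟩ := hq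
  refine mem_convexHull_of_exists_fintype q.1 (fun m => (g (q.2 m), f (q.2 m))) hw hw1
    (fun m => Set.mem_image_of_mem _ (hx m)) ?_
  ext1 <;> simp [Prod.fst_sum, Prod.snd_sum, average]

theorem sum_mem_decompositionValues {κ : Type*} [Fintype κ] {s : Set X} {w : κ → ℝ} {x : κ → X}
    (g : X → E) (f : X → ℝ) (hw : ∀ k, 0 ≤ w k) (hw1 : ∑ k, w k = 1) (hx : ∀ k, x k ∈ s) :
    ∑ k, w k * f (x k) ∈ decompositionValues s g f (∑ k, w k • g (x k)) := by
  have e := (Fintype.equivFin κ).symm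
  exact ⟨_, (w ∘ e, x ∘ e), ⟨fun _ => hw _, (e.sum_comp w).trans hw1, fun _ => hx _,
    (e.sum_comp fun k => w k • g (x k)).symm⟩, (e.sum_comp fun k => w k * f (x k)).symm⟩

/-- Carathéodory's theorem with a fixed number of points, obtained by padding with zero weights. -/
theorem exists_fin_of_mem_convexHull [FiniteDimensional ℝ E] {s : Set E} {p : E}
    (hp : p ∈ convexHull ℝ s) :
    ∃ (w : Fin (Module.finrank ℝ E + 1) → ℝ) (z : Fin (Module.finrank ℝ E + 1) → E),
      (∀ i, 0 ≤ w i) ∧ ∑ i, w i = 1 ∧ (∀ i, z i ∈ s) ∧ ∑ i, w i • z i = p := by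
  obtain ⟨x₀, hx₀⟩ := convexHull_nonempty_iff.1 ⟨p, hp⟩
  obtain ⟨κ, _, z, w, hz, hind, hw, hw1, hsum⟩ := eq_pos_convex_span_of_mem_convexHull hp
  have hcard : Fintype.card κ ≤ Fintype.card (Fin (Module.finrank ℝ E + 1)) := by
    rw [Fintype.card_fin]
    exact hind.card_le_finrank_succ.trans (Nat.succ_le_succ (Submodule.finrank_le _))
  obtain ⟨e⟩ := Function.Embedding.nonempty_of_card_le hcard
  have hwe (k : κ) : Function.extend e w 0 (e k) = w k := e.injective.extend_apply _ _ _
  have hze (k : κ) : Function.extend e z (fun _ => x₀) (e k) = z k := e.injective.extend_apply _ _ _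
  have hw0 (i) (hi : i ∉ Set.range e) : Function.extend e w 0 i = 0 :=
    Function.extend_apply' _ _ _ hi
  refine ⟨Function.extend e w 0, Function.extend e z fun _ => x₀, fun i => ?_, ?_, fun i => ?_, ?_⟩
  · by_cases hi : i ∈ Set.range e
    · obtain ⟨k, rfl⟩ := hi
      exact (hw k).le.trans_eq (hwe k).symm
    · exact (hw0 i hi).ge
  · exact (Fintype.sum_of_injective e e.injective _ _ hw0 fun k => (hwe k).symm).symm.trans hw1
  · by_cases hi : i ∈ Set.range e
    · obtain ⟨k, rfl⟩ := hi
      exact hze k ▸ hz ⟨k, rfl⟩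
    · rwa [Function.extend_apply' _ _ _ hi]
  · refine (Fintype.sum_of_injective e e.injective _ _ (fun i hi => ?_) fun k => ?_).symm.trans hsum
    · rw [hw0 i hi, zero_smul]
    · rw [hwe, hze]

theorem decompositionValues_eq_image [FiniteDimensional ℝ E] (s : Set X) (g : X → E) (f : X → ℝ)
    (p : E) :
    decompositionValues s g f p =
      average f '' decompositions s g p (Module.finrank ℝ (E × ℝ) + 1) := by
  refine Set.Subset.antisymm ?_ (by rintro _ ⟨q, hq, rfl⟩; exact ⟨_, q, hq, rfl⟩)
  rintro _ ⟨r, q, hq, rfl⟩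
  obtain ⟨w, z, hw, hw1, hz, hsum⟩ :=
    exists_fin_of_mem_convexHull (mem_convexHull_of_mem_decompositions hq f)
  choose x hx hxz using hz
  simp only [← hxz, Prod.ext_iff, Prod.fst_sum, Prod.snd_sum, Prod.smul_fst, Prod.smul_snd] at hsum
  exact ⟨(w, x), ⟨hw, hw1, hx, hsum.1.symm⟩, hsum.2⟩

variable [TopologicalSpace X] [TopologicalSpace Y]

theorem continuous_average {f : Y → X → ℝ} (hf : Continuous f.uncurry) (r : ℕ) :
    Continuous fun q : Y × (Fin r → ℝ) × (Fin r → X) => average (f q.1) q.2 :=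
  continuous_finsetSum _ fun m _ => by fun_prop

variable [TopologicalSpace E] [ContinuousAdd E] [ContinuousSMul ℝ E] [T2Space E]
  {s : Set X} {g : X → E}

theorem isCompact_decompositions (hs : IsCompact s) (hg : Continuous g) (p : E) (r : ℕ) :
    IsCompact (decompositions s g p r) := by
  have hclosed : IsClosed {q : (Fin r → ℝ) × (Fin r → X) | p = ∑ m, q.1 m • g (q.2 m)} :=
    isClosed_eq continuous_const (by fun_prop)
  convert ((isCompact_stdSimplex ℝ (Fin r)).prod
    (isCompact_univ_pi fun _ => hs)).inter_right hclosed using 1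
  ext q
  simp [decompositions, stdSimplex, and_assoc]

variable [FiniteDimensional ℝ E]

theorem isCompact_decompositionValues (hs : IsCompact s) (hg : Continuous g) {f : X → ℝ}
    (hf : Continuous f) (p : E) : IsCompact (decompositionValues s g f p) := by
  rw [decompositionValues_eq_image]
  refine (isCompact_decompositions hs hg p _).image ?_
  exact (continuous_average (Y := Unit) (f := fun _ => f) (by fun_prop) _).comp
    (Continuous.prodMk_right ())

theorem continuous_sSup_decompositionValues (hs : IsCompact s) (hg : Continuous g) {f : Y → X → ℝ}
    (hf : Continuous f.uncurry) (p : E) :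
    Continuous fun y => sSup (decompositionValues s g (f y) p) := by
  simp only [decompositionValues_eq_image]
  exact (isCompact_decompositions hs hg p _).continuous_sSup (continuous_average hf _)

end Decompositions

/-! ### A variational formula for the quantum Fisher information -/

section Trace

variable {m n : Type*} [Fintype m] [Fintype n]

theorem re_trace_conjTranspose_mul_self (A : Matrix m n ℂ) :
    (Aᴴ * A).trace.re = ∑ i, ∑ j, ‖A i j‖ ^ 2 := by
  rw [Finset.sum_comm]
  simp [Matrix.trace, Matrix.mul_apply, ← Complex.normSq_eq_conj_mul_self,
    Complex.normSq_eq_norm_sq, -Complex.ofReal_pow]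

theorem re_trace_nonneg {ρ : Matrix n n ℂ} (hρ : ρ.PosSemidef) : 0 ≤ ρ.trace.re :=
  (Complex.nonneg_iff.1 hρ.trace_nonneg).1

theorem trace_isometry_conj [DecidableEq n] {W : Matrix m n ℂ} (hW : Wᴴ * W = 1)
    (A : Matrix n n ℂ) : (W * A * Wᴴ).trace = A.trace := by
  rw [Matrix.trace_mul_comm, ← Matrix.mul_assoc, hW, Matrix.one_mul]

theorem re_trace_conj_isometry_le [DecidableEq n] {W : Matrix m n ℂ}
    (hW : Wᴴ * W = 1) {ρ : Matrix m m ℂ} (hρ : ρ.PosSemidef) :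
    (Wᴴ * ρ * W).trace.re ≤ ρ.trace.re := by
  classical
  have hidem : (1 - W * Wᴴ) * (1 - W * Wᴴ) = 1 - W * Wᴴ := by
    have : W * Wᴴ * (W * Wᴴ) = W * Wᴴ := by
      rw [Matrix.mul_assoc, ← Matrix.mul_assoc Wᴴ, hW, Matrix.one_mul]
    rw [Matrix.mul_sub, Matrix.sub_mul, Matrix.sub_mul, this]
    simp
  have hsub : ((1 - W * Wᴴ) * ρ * (1 - W * Wᴴ)ᴴ).trace = ρ.trace - (Wᴴ * ρ * W).trace := by
    rw [Matrix.conjTranspose_sub, Matrix.conjTranspose_mul, Matrix.conjTranspose_conjTranspose,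
      Matrix.conjTranspose_one, Matrix.trace_mul_comm, ← Matrix.mul_assoc, hidem, Matrix.sub_mul,
      Matrix.trace_sub, Matrix.one_mul, Matrix.mul_assoc W, Matrix.trace_mul_comm W]
  have hpos := re_trace_nonneg (hρ.mul_mul_conjTranspose_same (1 - W * Wᴴ))
  rw [hsub, Complex.sub_re] at hpos
  linarith

theorem isCompact_setOf_re_trace_conjTranspose_mul_self_le (R : ℝ) :
    IsCompact {A : Matrix m n ℂ | (Aᴴ * A).trace.re ≤ R} := by
  have hbox : IsCompact (Set.univ.pi fun _ : m => Set.univ.pi fun _ : n =>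
      Metric.closedBall (0 : ℂ) √R) :=
    isCompact_univ_pi fun _ => isCompact_univ_pi fun _ => isCompact_closedBall _ _
  have hclosed : IsClosed {A : Matrix m n ℂ | (Aᴴ * A).trace.re ≤ R} :=
    isClosed_le (by fun_prop) continuous_const
  refine hbox.of_isClosed_subset hclosed fun (A : Matrix m n ℂ) hA i _ j _ => ?_
  rw [mem_closedBall_zero_iff]
  refine Real.le_sqrt_of_sq_le (le_trans ?_ hA)
  rw [re_trace_conjTranspose_mul_self]
  calc ‖A i j‖ ^ 2 ≤ ∑ j, ‖A i j‖ ^ 2 :=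
        Finset.single_le_sum (f := fun j => ‖A i j‖ ^ 2) (fun j _ => by positivity)
          (Finset.mem_univ j)
    _ ≤ ∑ i, ∑ j, ‖A i j‖ ^ 2 :=
        Finset.single_le_sum (f := fun i => ∑ j, ‖A i j‖ ^ 2) (fun i _ => by positivity)
          (Finset.mem_univ i)

end Trace

section Fisher

variable {ι κ : Type} [Fintype ι] [Fintype κ]

/-- The functional `2 Re Tr[A† [ρ, H]] - ½ Tr[ρ (A† A + A A†)]` of an arbitrary operator `A`, whose
maximum over `A` is the quantum Fisher information of `ρ`. It is linear in `ρ`. -/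
def fisherDual (ρ H A : Matrix ι ι ℂ) : ℝ :=
  2 * (Aᴴ * (ρ * H - H * ρ)).trace.re -
    1 / 2 * ((A * ρ * Aᴴ).trace.re + (Aᴴ * ρ * A).trace.re)

theorem fisherDual_sum {ν : Type*} (s : Finset ν) (ρ : ν → Matrix ι ι ℂ) (H A : Matrix ι ι ℂ) :
    fisherDual (∑ n ∈ s, ρ n) H A = ∑ n ∈ s, fisherDual (ρ n) H A := by
  simp only [fisherDual, Finset.sum_mul, Finset.mul_sum, Matrix.trace_sum, Complex.re_sum,
    ← Finset.sum_sub_distrib, ← Finset.sum_add_distrib]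

theorem fisherDual_smul (c : ℝ) (ρ H A : Matrix ι ι ℂ) :
    fisherDual (c • ρ) H A = c * fisherDual ρ H A := by
  simp only [fisherDual, Matrix.smul_mul, Matrix.mul_smul, ← smul_sub, Matrix.trace_smul,
    Complex.smul_re, smul_eq_mul]
  ring

theorem fisherDual_smul_right (t : ℝ) (ρ H A : Matrix ι ι ℂ) :
    fisherDual ρ H (t • A) = 2 * t * (Aᴴ * (ρ * H - H * ρ)).trace.re -
      t ^ 2 * (1 / 2 * ((A * ρ * Aᴴ).trace.re + (Aᴴ * ρ * A).trace.re)) := by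
  simp only [fisherDual, Matrix.conjTranspose_smul, star_trivial, Matrix.smul_mul, Matrix.mul_smul,
    Matrix.trace_smul, Complex.smul_re, smul_eq_mul]
  ring

theorem continuous_fisherDual (H : Matrix ι ι ℂ) :
    Continuous fun q : Matrix ι ι ℂ × Matrix ι ι ℂ => fisherDual q.1 H q.2 := by
  unfold fisherDual
  fun_prop

theorem fisherDual_isometry_conj [DecidableEq ι] {W : Matrix κ ι ℂ} (hW : Wᴴ * W = 1)
    {H A : Matrix κ κ ℂ} {H' A' : Matrix ι ι ℂ} (hHW : H * W = W * H') (hWH : Wᴴ * H = H' * Wᴴ)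
    (hAW : A * W = W * A') (hWA : Wᴴ * A = A' * Wᴴ) (ρ : Matrix ι ι ℂ) :
    fisherDual (W * ρ * Wᴴ) H A = fisherDual ρ H' A' := by
  have hAW' : Aᴴ * W = W * A'ᴴ := by simpa using congrArg Matrix.conjTranspose hWA
  have hWA' : Wᴴ * Aᴴ = A'ᴴ * Wᴴ := by simpa using congrArg Matrix.conjTranspose hAW
  have hlin : Aᴴ * (W * ρ * Wᴴ * H - H * (W * ρ * Wᴴ)) =
      W * (A'ᴴ * (ρ * H' - H' * ρ)) * Wᴴ := by
    simp only [Matrix.mul_sub, Matrix.sub_mul, Matrix.mul_assoc, hWH]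
    simp only [← Matrix.mul_assoc, hHW, hAW']
  have hquad (B : Matrix κ κ ℂ) (B' : Matrix ι ι ℂ) (hBW : B * W = W * B')
      (hWB : Wᴴ * Bᴴ = B'ᴴ * Wᴴ) : B * (W * ρ * Wᴴ) * Bᴴ = W * (B' * ρ * B'ᴴ) * Wᴴ := by
    simp only [Matrix.mul_assoc, hWB]
    simp only [← Matrix.mul_assoc, hBW]
  have hquad' := hquad Aᴴ A'ᴴ hAW' (by simpa using hWA)
  simp only [Matrix.conjTranspose_conjTranspose] at hquad'
  simp only [fisherDual, hlin, hquad A A' hAW hWA', hquad', trace_isometry_conj hW]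

variable [DecidableEq ι]

theorem fisherDual_isometry_conj_le {W : Matrix κ ι ℂ} (hW : Wᴴ * W = 1) {H : Matrix κ κ ℂ}
    {H' : Matrix ι ι ℂ} (hHW : H * W = W * H') (hWH : Wᴴ * H = H' * Wᴴ) {ρ : Matrix ι ι ℂ}
    (hρ : ρ.PosSemidef) (A : Matrix κ κ ℂ) :
    fisherDual (W * ρ * Wᴴ) H A ≤ fisherDual ρ H' (Wᴴ * A * W) := by
  have hlin : (Aᴴ * (W * ρ * Wᴴ * H - H * (W * ρ * Wᴴ))).trace =
      ((Wᴴ * A * W)ᴴ * (ρ * H' - H' * ρ)).trace := by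
    have : W * ρ * Wᴴ * H - H * (W * ρ * Wᴴ) = W * (ρ * H' - H' * ρ) * Wᴴ := by
      simp only [Matrix.mul_sub, Matrix.sub_mul, Matrix.mul_assoc, hWH]
      simp only [← Matrix.mul_assoc, hHW]
    rw [this, ← Matrix.mul_assoc, Matrix.trace_mul_comm]
    simp only [Matrix.conjTranspose_mul, Matrix.conjTranspose_conjTranspose, Matrix.mul_assoc]
  have hquad (B : Matrix κ κ ℂ) :
      ((Wᴴ * B * W) * ρ * (Wᴴ * B * W)ᴴ).trace.re ≤ (B * (W * ρ * Wᴴ) * Bᴴ).trace.re := by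
    have := re_trace_conj_isometry_le hW
      ((hρ.mul_mul_conjTranspose_same W).mul_mul_conjTranspose_same B)
    simpa only [Matrix.conjTranspose_mul, Matrix.conjTranspose_conjTranspose, Matrix.mul_assoc]
  have hquad' := hquad Aᴴ
  simp only [Matrix.conjTranspose_mul, Matrix.conjTranspose_conjTranspose, Matrix.mul_assoc]
    at hquad' hquad hlin ⊢
  simp only [fisherDual, Matrix.conjTranspose_mul, Matrix.conjTranspose_conjTranspose,
    Matrix.mul_assoc, hlin]
  linarith [hquad A]

theorem fisherDual_diagonal (w : ι → ℝ) (H A : Matrix ι ι ℂ) :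
    fisherDual (Matrix.diagonal fun i => (w i : ℂ)) H A =
      ∑ i, ∑ j, (2 * (w i - w j) * (star (A i j) * H i j).re
        - 1 / 2 * (w i + w j) * ‖A i j‖ ^ 2) := by
  have hcomm : (Aᴴ * ((Matrix.diagonal fun i => (w i : ℂ)) * H -
      H * Matrix.diagonal fun i => (w i : ℂ))).trace.re =
      ∑ i, ∑ j, (w i - w j) * (star (A i j) * H i j).re := by
    rw [Finset.sum_comm]
    simp only [Matrix.trace, Matrix.diag, Matrix.mul_apply (M := Aᴴ), Complex.re_sum,
      Matrix.sub_apply, Matrix.conjTranspose_apply, Matrix.diagonal_mul, Matrix.mul_diagonal]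
    refine Finset.sum_congr rfl fun i _ => Finset.sum_congr rfl fun j _ => ?_
    rw [← Complex.re_ofReal_mul, Complex.ofReal_sub]
    ring_nf
  have hquad (B : Matrix ι ι ℂ) : (B * (Matrix.diagonal fun i => (w i : ℂ)) * Bᴴ).trace.re =
      ∑ i, ∑ j, w j * ‖B i j‖ ^ 2 := by
    simp only [Matrix.trace, Matrix.diag, Matrix.mul_apply (N := Bᴴ), Complex.re_sum,
      Matrix.conjTranspose_apply, Matrix.mul_diagonal]
    refine Finset.sum_congr rfl fun i _ => Finset.sum_congr rfl fun j _ => ?_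
    rw [mul_right_comm, Complex.star_def, Complex.mul_conj', mul_comm]
    norm_cast
  have hquad' := hquad Aᴴ
  rw [Matrix.conjTranspose_conjTranspose, Finset.sum_comm] at hquad'
  simp only [Matrix.conjTranspose_apply, norm_star] at hquad'
  simp only [fisherDual, hcomm, hquad A, hquad', Finset.mul_sum, ← Finset.sum_sub_distrib,
    ← Finset.sum_add_distrib]
  exact Finset.sum_congr rfl fun i _ => Finset.sum_congr rfl fun j _ => by ring

/-- The square is completed at `a = 2 (x - y) / (x + y) * h`; for `x + y = 0` both sides vanish. -/
theorem fisherDual_term_eq_sub_sq {x y : ℝ} (hx : 0 ≤ x) (hy : 0 ≤ y) (a h : ℂ) :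
    2 * (x - y) * (star a * h).re - 1 / 2 * (x + y) * ‖a‖ ^ 2 =
      2 * ((x - y) ^ 2 / (x + y) * ‖h‖ ^ 2) -
        1 / 2 * ((x + y) * ‖a - (2 * (x - y) / (x + y) : ℝ) * h‖ ^ 2) := by
  rcases (add_nonneg hx hy).eq_or_lt with hs | hs
  · obtain ⟨rfl, rfl⟩ := (add_eq_zero_iff_of_nonneg hx hy).1 hs.symm
    simp
  · rw [← Complex.normSq_eq_norm_sq, ← Complex.normSq_eq_norm_sq, ← Complex.normSq_eq_norm_sq,
      Complex.normSq_apply, Complex.normSq_apply, Complex.normSq_apply, Complex.sub_re,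
      Complex.sub_im, Complex.re_ofReal_mul, Complex.im_ofReal_mul, Complex.mul_re,
      Complex.star_def, Complex.conj_re, Complex.conj_im]
    field_simp
    ring

theorem qfi_eq_of_isHermitian {ρ : Matrix ι ι ℂ} (hρ : ρ.IsHermitian) (H : Matrix ι ι ℂ) :
    qfi ρ H = 2 * ∑ i, ∑ j, (hρ.eigenvalues i - hρ.eigenvalues j) ^ 2 /
        (hρ.eigenvalues i + hρ.eigenvalues j) *
      ‖(star (hρ.eigenvectorUnitary : Matrix ι ι ℂ) * H *
        (hρ.eigenvectorUnitary : Matrix ι ι ℂ)) i j‖ ^ 2 :=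
  dif_pos hρ

theorem fisherDual_eq_qfi_sub {ρ : Matrix ι ι ℂ} (hρ : ρ.PosSemidef) (H A : Matrix ι ι ℂ) :
    let w := hρ.isHermitian.eigenvalues
    let U : Matrix ι ι ℂ := hρ.isHermitian.eigenvectorUnitary
    fisherDual ρ H A = qfi ρ H - 1 / 2 * ∑ i, ∑ j, (w i + w j) *
      ‖(Uᴴ * A * U) i j - (2 * (w i - w j) / (w i + w j) : ℝ) * (Uᴴ * H * U) i j‖ ^ 2 := by
  intro w U
  have hU : Uᴴ * U = 1 := Unitary.star_mul_self_of_mem hρ.isHermitian.eigenvectorUnitary.2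
  have hU' : U * Uᴴ = 1 := Unitary.mul_star_self_of_mem hρ.isHermitian.eigenvectorUnitary.2
  have hspec : ρ = U * (Matrix.diagonal fun i => (w i : ℂ)) * Uᴴ :=
    hρ.isHermitian.spectral_theorem
  have hleft (B : Matrix ι ι ℂ) : B * U = U * (Uᴴ * B * U) := by
    simp only [← Matrix.mul_assoc, hU', Matrix.one_mul]
  have hright (B : Matrix ι ι ℂ) : Uᴴ * B = Uᴴ * B * U * Uᴴ := by
    rw [Matrix.mul_assoc _ U, hU', Matrix.mul_one]
  calc fisherDual ρ H A = fisherDual (Matrix.diagonal fun i => (w i : ℂ)) (Uᴴ * H * U)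
        (Uᴴ * A * U) := by
        conv_lhs => rw [hspec]
        exact fisherDual_isometry_conj hU (hleft H) (hright H) (hleft A) (hright A) _
    _ = _ := by
        rw [fisherDual_diagonal, qfi_eq_of_isHermitian hρ.isHermitian]
        simp only [Finset.mul_sum, ← Finset.sum_sub_distrib]
        exact Finset.sum_congr rfl fun i _ => Finset.sum_congr rfl fun j _ =>
          fisherDual_term_eq_sub_sq (hρ.eigenvalues_nonneg i) (hρ.eigenvalues_nonneg j) _ _

theorem fisherDual_le_qfi {ρ : Matrix ι ι ℂ} (hρ : ρ.PosSemidef) (H A : Matrix ι ι ℂ) :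
    fisherDual ρ H A ≤ qfi ρ H := by
  rw [fisherDual_eq_qfi_sub hρ]
  refine sub_le_self _ (mul_nonneg (by norm_num) ?_)
  exact Finset.sum_nonneg fun i _ => Finset.sum_nonneg fun j _ => mul_nonneg
    (add_nonneg (hρ.eigenvalues_nonneg i) (hρ.eigenvalues_nonneg j)) (sq_nonneg _)

theorem sq_two_mul_sub_div_add_le {x y : ℝ} (hx : 0 ≤ x) (hy : 0 ≤ y) :
    (2 * (x - y) / (x + y)) ^ 2 ≤ 4 := by
  rw [div_pow]
  refine div_le_of_le_mul₀ (by positivity) (by norm_num) ?_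
  nlinarith [mul_nonneg hx hy]

theorem exists_fisherDual_eq_qfi {ρ : Matrix ι ι ℂ} (hρ : ρ.PosSemidef) (H : Matrix ι ι ℂ) :
    ∃ A : Matrix ι ι ℂ, (Aᴴ * A).trace.re ≤ 4 * (Hᴴ * H).trace.re ∧
      fisherDual ρ H A = qfi ρ H := by
  set w := hρ.isHermitian.eigenvalues with hw
  set U : Matrix ι ι ℂ := (hρ.isHermitian.eigenvectorUnitary : Matrix ι ι ℂ) with hUdef
  have hU : Uᴴ * U = 1 := Unitary.star_mul_self_of_mem hρ.isHermitian.eigenvectorUnitary.2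
  have hU' : U * Uᴴ = 1 := Unitary.mul_star_self_of_mem hρ.isHermitian.eigenvectorUnitary.2
  let B : Matrix ι ι ℂ := Matrix.of fun i j =>
    ((2 * (w i - w j) / (w i + w j) : ℝ) : ℂ) * (Uᴴ * H * U) i j
  have hB : Uᴴ * (U * B * Uᴴ) * U = B := by
    rw [Matrix.mul_assoc U, ← Matrix.mul_assoc, hU, Matrix.one_mul, Matrix.mul_assoc, hU,
      Matrix.mul_one]
  have htrace (X : Matrix ι ι ℂ) : ((Uᴴ * X * U)ᴴ * (Uᴴ * X * U)).trace = (Xᴴ * X).trace := by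
    rw [← trace_isometry_conj (W := Uᴴ) (by simpa using hU') (Xᴴ * X)]
    congr 1
    simp only [Matrix.conjTranspose_mul, Matrix.conjTranspose_conjTranspose, Matrix.mul_assoc]
    rw [← Matrix.mul_assoc U, hU', Matrix.one_mul]
  refine ⟨U * B * Uᴴ, ?_, ?_⟩
  · rw [← htrace (U * B * Uᴴ), hB, ← htrace H, re_trace_conjTranspose_mul_self,
      re_trace_conjTranspose_mul_self]
    simp only [Finset.mul_sum]
    refine Finset.sum_le_sum fun i _ => Finset.sum_le_sum fun j _ => ?_
    have hBij : B i j = ((2 * (w i - w j) / (w i + w j) : ℝ) : ℂ) * (Uᴴ * H * U) i j := rfl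
    rw [hBij, norm_mul, mul_pow, Complex.norm_real, Real.norm_eq_abs, sq_abs]
    gcongr
    exact sq_two_mul_sub_div_add_le (hρ.eigenvalues_nonneg i) (hρ.eigenvalues_nonneg j)
  · rw [fisherDual_eq_qfi_sub hρ, ← hUdef, ← hw, hB]
    simp [B]

theorem continuousOn_qfi (H : Matrix ι ι ℂ) :
    ContinuousOn (fun ρ : Matrix ι ι ℂ => qfi ρ H) {ρ | ρ.PosSemidef} := by
  have hsup : Continuous fun ρ : Matrix ι ι ℂ =>
      sSup (fisherDual ρ H '' {A | (Aᴴ * A).trace.re ≤ 4 * (Hᴴ * H).trace.re}) :=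
    (isCompact_setOf_re_trace_conjTranspose_mul_self_le _).continuous_sSup (continuous_fisherDual H)
  refine hsup.continuousOn.congr fun ρ hρ => ?_
  obtain ⟨A, hA, hAq⟩ := exists_fisherDual_eq_qfi hρ H
  have hgreatest : IsGreatest (fisherDual ρ H '' {A | (Aᴴ * A).trace.re ≤ 4 * (Hᴴ * H).trace.re})
      (qfi ρ H) :=
    ⟨⟨A, hA, hAq⟩, Set.forall_mem_image.2 fun B _ => fisherDual_le_qfi hρ H B⟩
  exact hgreatest.csSup_eq.symm

theorem qfi_sum_le {ν : Type*} (s : Finset ν) {ρ : ν → Matrix ι ι ℂ}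
    (hρ : ∀ n ∈ s, (ρ n).PosSemidef) (H : Matrix ι ι ℂ) :
    qfi (∑ n ∈ s, ρ n) H ≤ ∑ n ∈ s, qfi (ρ n) H := by
  obtain ⟨A, -, hA⟩ := exists_fisherDual_eq_qfi (Matrix.posSemidef_sum s hρ) H
  rw [← hA, fisherDual_sum]
  exact Finset.sum_le_sum fun n hn => fisherDual_le_qfi (hρ n hn) H A

theorem qfi_smul {ρ : Matrix ι ι ℂ} (hρ : ρ.PosSemidef) (H : Matrix ι ι ℂ) {c : ℝ} (hc : 0 ≤ c) :
    qfi (c • ρ) H = c * qfi ρ H := by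
  apply le_antisymm
  · obtain ⟨A, -, hA⟩ := exists_fisherDual_eq_qfi (hρ.smul hc) H
    rw [← hA, fisherDual_smul]
    exact mul_le_mul_of_nonneg_left (fisherDual_le_qfi hρ H A) hc
  · obtain ⟨A, -, hA⟩ := exists_fisherDual_eq_qfi hρ H
    rw [← hA, ← fisherDual_smul]
    exact fisherDual_le_qfi (hρ.smul hc) H A

theorem qfi_nonneg {ρ : Matrix ι ι ℂ} (hρ : ρ.PosSemidef) (H : Matrix ι ι ℂ) : 0 ≤ qfi ρ H := by
  simpa [fisherDual] using fisherDual_le_qfi hρ H 0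

theorem qfi_eq_zero_iff_commute {ρ : Matrix ι ι ℂ} (hρ : ρ.PosSemidef) {H : Matrix ι ι ℂ} :
    qfi ρ H = 0 ↔ Commute ρ H := by
  constructor
  · intro h
    set A := ρ * H - H * ρ with hA
    set q := (A * ρ * Aᴴ).trace.re + (Aᴴ * ρ * A).trace.re with hq
    have hbound (t : ℝ) : 0 ≤ 1 / 2 * q * (t * t) + -2 * (Aᴴ * A).trace.re * t + 0 := by
      have := (fisherDual_le_qfi hρ H (t • A)).trans_eq h
      rw [fisherDual_smul_right, ← hA, ← hq] at this
      linarith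
    have hdiscrim := discrim_le_zero hbound
    rw [discrim, mul_zero, sub_zero] at hdiscrim
    have hre : (Aᴴ * A).trace.re = 0 := by nlinarith
    have him : (Aᴴ * A).trace.im = 0 :=
      (Complex.nonneg_iff.1 (Matrix.posSemidef_conjTranspose_mul_self A).trace_nonneg).2.symm
    exact sub_eq_zero.1 (Matrix.trace_conjTranspose_mul_self_eq_zero_iff.1 (Complex.ext hre him))
  · intro h
    refine le_antisymm ?_ (qfi_nonneg hρ H)
    obtain ⟨A, -, hA⟩ := exists_fisherDual_eq_qfi hρ H
    have hleft := re_trace_nonneg (hρ.mul_mul_conjTranspose_same A)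
    have hright := re_trace_nonneg (hρ.conjTranspose_mul_mul_same A)
    rw [← hA, fisherDual, h.eq, sub_self, Matrix.mul_zero, Matrix.trace_zero]
    simp only [Complex.zero_re]
    linarith

theorem qfi_directSum [DecidableEq κ] {ν : Type*} [Fintype ν] {γ : ν → Type} [∀ n, Fintype (γ n)]
    [∀ n, DecidableEq (γ n)] {W : ∀ n, Matrix κ (γ n) ℂ} (hW : ∀ n, (W n)ᴴ * W n = 1)
    (hWW : ∀ n m, n ≠ m → (W n)ᴴ * W m = 0) {H : Matrix κ κ ℂ} {H' : ∀ n, Matrix (γ n) (γ n) ℂ}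
    (hHW : ∀ n, H * W n = W n * H' n) (hWH : ∀ n, (W n)ᴴ * H = H' n * (W n)ᴴ)
    {ρ : ∀ n, Matrix (γ n) (γ n) ℂ} (hρ : ∀ n, (ρ n).PosSemidef) :
    qfi (∑ n, W n * ρ n * (W n)ᴴ) H = ∑ n, qfi (ρ n) (H' n) := by
  have hpos : (∑ n, W n * ρ n * (W n)ᴴ).PosSemidef :=
    Matrix.posSemidef_sum _ fun n _ => (hρ n).mul_mul_conjTranspose_same (W n)
  apply le_antisymm
  · obtain ⟨A, -, hA⟩ := exists_fisherDual_eq_qfi hpos H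
    rw [← hA, fisherDual_sum]
    exact Finset.sum_le_sum fun n _ =>
      (fisherDual_isometry_conj_le (hW n) (hHW n) (hWH n) (hρ n) A).trans
        (fisherDual_le_qfi (hρ n) _ _)
  · choose B _ hB using fun n => exists_fisherDual_eq_qfi (hρ n) (H' n)
    let A := ∑ n, W n * B n * (W n)ᴴ
    have hAW (n : ν) : A * W n = W n * B n := by
      rw [Matrix.sum_mul, Fintype.sum_eq_single n]
      · rw [Matrix.mul_assoc, hW, Matrix.mul_one]
      · intro m hmn
        rw [Matrix.mul_assoc, hWW m n hmn, Matrix.mul_zero]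
    have hWA (n : ν) : (W n)ᴴ * A = B n * (W n)ᴴ := by
      rw [Matrix.mul_sum, Fintype.sum_eq_single n]
      · rw [← Matrix.mul_assoc, ← Matrix.mul_assoc, hW, Matrix.one_mul]
      · intro m hmn
        rw [← Matrix.mul_assoc, ← Matrix.mul_assoc, hWW n m hmn.symm, Matrix.zero_mul,
          Matrix.zero_mul]
    calc ∑ n, qfi (ρ n) (H' n) = fisherDual (∑ n, W n * ρ n * (W n)ᴴ) H A := by
          rw [fisherDual_sum]
          refine Finset.sum_congr rfl fun n _ => ?_
          rw [fisherDual_isometry_conj (hW n) (hHW n) (hWH n) (hAW n) (hWA n), hB]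
      _ ≤ _ := fisherDual_le_qfi hpos H A

end Fisher

/-! ### Relabellings and incoherent Kraus operators -/

section Relabel

variable {α β γ : Type} [DecidableEq β]

/-- The operator sending the basis vector `x` to the basis vector `f x`. -/
def relabel (f : α → β) : Matrix β α ℂ := (1 : Matrix β β ℂ).submatrix id f

theorem relabel_apply (f : α → β) (y : β) (x : α) : relabel f y x = if y = f x then 1 else 0 :=
  Matrix.one_apply

theorem relabel_prodMap_id [DecidableEq γ] (f : α → β) :
    relabel (Prod.map (id : γ → γ) f) = (1 : Matrix γ γ ℂ) ⊗ₖ relabel f := by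
  rw [relabel, relabel, Matrix.kroneckerMap_submatrix_right, Matrix.one_kronecker_one]
  rfl

theorem relabel_mulVec_apply [Fintype α] {f : α → β} (hf : Function.Injective f) (ψ : α → ℂ)
    (x : α) : (relabel f *ᵥ ψ) (f x) = ψ x := by
  classical
  simp [Matrix.mulVec, dotProduct, relabel_apply, hf.eq_iff]

theorem mem_range_of_relabel_conj_apply_ne_zero [Fintype α] {f : α → β} {σ : Matrix α α ℂ} {y z : β}
    (h : (relabel f * σ * (relabel f)ᴴ) y z ≠ 0) : y ∈ Set.range f ∧ z ∈ Set.range f := by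
  rw [Matrix.mul_apply] at h
  obtain ⟨v, -, hv⟩ := Finset.exists_ne_zero_of_sum_ne_zero h
  have hleft := left_ne_zero_of_mul hv
  rw [Matrix.mul_apply] at hleft
  obtain ⟨u, -, hu⟩ := Finset.exists_ne_zero_of_sum_ne_zero hleft
  have hy := left_ne_zero_of_mul hu
  have hz := star_ne_zero.1 (right_ne_zero_of_mul hv)
  simp only [Matrix.transpose_apply, relabel_apply, ne_eq, ite_eq_right_iff, one_ne_zero,
    imp_false, not_not] at hy hz
  exact ⟨⟨u, hy.symm⟩, ⟨v, hz.symm⟩⟩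

variable [Fintype β]

theorem mul_relabel (X : Matrix γ β ℂ) (f : α → β) : X * relabel f = X.submatrix id f := by
  simpa [relabel] using (Matrix.submatrix_mul X 1 id id f Function.bijective_id).symm

theorem conjTranspose_relabel_mul (f : α → β) (X : Matrix β γ ℂ) :
    (relabel f)ᴴ * X = X.submatrix f id := by
  simpa [relabel] using (Matrix.submatrix_mul 1 X f id id Function.bijective_id).symm

theorem conjTranspose_relabel_mul_self [DecidableEq α] {f : α → β} (hf : Function.Injective f) :
    (relabel f)ᴴ * relabel f = 1 := by
  rw [conjTranspose_relabel_mul]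
  exact Matrix.submatrix_one f hf

theorem conjTranspose_relabel_mul_of_ne {f : α → β} {g : γ → β} (h : ∀ x y, f x ≠ g y) :
    (relabel f)ᴴ * relabel g = 0 := by
  rw [conjTranspose_relabel_mul]
  ext x y
  simp [relabel_apply, h]

theorem trace_relabel_conj_mul [Fintype α] (f : α → β) (σ : Matrix α α ℂ) (B : Matrix β β ℂ) :
    (relabel f * σ * (relabel f)ᴴ * B).trace = (σ * B.submatrix f f).trace := by
  rw [Matrix.mul_assoc, conjTranspose_relabel_mul, Matrix.trace_mul_comm, ← Matrix.mul_assoc,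
    mul_relabel, Matrix.trace_mul_comm, Matrix.submatrix_submatrix]
  rfl

variable [Fintype α] [DecidableEq α] [Fintype γ] [DecidableEq γ]

theorem kronecker_one_mul_relabel (f : α → β) (A : Matrix γ γ ℂ) :
    A ⊗ₖ (1 : Matrix β β ℂ) * relabel (Prod.map (id : γ → γ) f) =
      relabel (Prod.map (id : γ → γ) f) * A ⊗ₖ (1 : Matrix α α ℂ) := by
  rw [relabel_prodMap_id, ← Matrix.mul_kronecker_mul, ← Matrix.mul_kronecker_mul]
  simp only [Matrix.one_mul, Matrix.mul_one]

theorem conjTranspose_relabel_mul_kronecker_one (f : α → β) (A : Matrix γ γ ℂ) :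
    (relabel (Prod.map (id : γ → γ) f))ᴴ * A ⊗ₖ (1 : Matrix β β ℂ) =
      A ⊗ₖ (1 : Matrix α α ℂ) * (relabel (Prod.map (id : γ → γ) f))ᴴ := by
  rw [relabel_prodMap_id, Matrix.conjTranspose_kronecker, ← Matrix.mul_kronecker_mul,
    ← Matrix.mul_kronecker_mul]
  simp only [Matrix.conjTranspose_one, Matrix.one_mul, Matrix.mul_one]

end Relabel

section WeightedRelabel

variable {ι κ μ : Type} [Fintype ι] [DecidableEq ι] [Fintype κ] [DecidableEq κ]

/-- The operator sending the basis vector `j` to `c j` times the basis vector `f j`. -/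
def weightedRelabel (f : ι → κ) (c : ι → ℂ) : Matrix κ ι ℂ := relabel f * Matrix.diagonal c

omit [Fintype κ] in
theorem weightedRelabel_apply (f : ι → κ) (c : ι → ℂ) (x : κ) (j : ι) :
    weightedRelabel f c x j = if x = f j then c j else 0 := by
  simp [weightedRelabel, relabel_apply]

omit [Fintype κ] in
theorem weightedRelabel_smul (f : ι → κ) (s : ℂ) (c : ι → ℂ) :
    weightedRelabel f (s • c) = s • weightedRelabel f c := by
  rw [weightedRelabel, weightedRelabel, ← Matrix.mul_smul, Matrix.diagonal_smul]

theorem relabel_mul_weightedRelabel [DecidableEq μ] (g : κ → μ) (f : ι → κ) (c : ι → ℂ) :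
    relabel g * weightedRelabel f c = weightedRelabel (g ∘ f) c := by
  rw [weightedRelabel, weightedRelabel, ← Matrix.mul_assoc, mul_relabel]
  rfl

omit [Fintype κ] in
theorem continuous_weightedRelabel (f : ι → κ) : Continuous (weightedRelabel f) :=
  continuous_const.matrix_mul continuous_id.matrix_diagonal

theorem trace_conjTranspose_weightedRelabel_mul_self (f : ι → κ) (c : ι → ℂ) :
    ((weightedRelabel f c)ᴴ * weightedRelabel f c).trace.re = ∑ j, ‖c j‖ ^ 2 := by
  rw [re_trace_conjTranspose_mul_self, Finset.sum_comm]
  simp [weightedRelabel_apply, apply_ite norm, ite_pow]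

end WeightedRelabel

section IsColumnSparse

variable {ι κ μ : Type}

/-- Each column has at most one nonzero entry. This characterizes the operators that map diagonal
matrices to diagonal matrices. -/
def IsColumnSparse (K : Matrix κ ι ℂ) : Prop := ∀ j x y, K x j ≠ 0 → K y j ≠ 0 → x = y

namespace IsColumnSparse

theorem mul [Fintype κ] {L : Matrix μ κ ℂ} {K : Matrix κ ι ℂ} (hL : IsColumnSparse L)
    (hK : IsColumnSparse K) : IsColumnSparse (L * K) := by
  intro j x y hx hy
  rw [Matrix.mul_apply] at hx hy
  obtain ⟨u, -, hu⟩ := Finset.exists_ne_zero_of_sum_ne_zero hx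
  obtain ⟨v, -, hv⟩ := Finset.exists_ne_zero_of_sum_ne_zero hy
  obtain rfl : u = v := hK j u v (right_ne_zero_of_mul hu) (right_ne_zero_of_mul hv)
  exact hL u x y (left_ne_zero_of_mul hu) (left_ne_zero_of_mul hv)

theorem isDiag_conj [Fintype ι] {K : Matrix κ ι ℂ} (hK : IsColumnSparse K) {δ : Matrix ι ι ℂ}
    (hδ : δ.IsDiag) : (K * δ * Kᴴ).IsDiag := by
  classical
  intro x y hxy
  rw [← hδ.diagonal_diag, Matrix.mul_apply]
  refine Finset.sum_eq_zero fun j _ => ?_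
  rw [Matrix.mul_diagonal, Matrix.conjTranspose_apply]
  by_contra hne
  exact hxy (hK j x y (left_ne_zero_of_mul (left_ne_zero_of_mul hne))
    (star_ne_zero.1 (right_ne_zero_of_mul hne)))

theorem exists_eq_weightedRelabel [Fintype ι] [DecidableEq ι] [DecidableEq κ] [Nonempty κ]
    {K : Matrix κ ι ℂ} (hK : IsColumnSparse K) :
    ∃ (f : ι → κ) (c : ι → ℂ), K = weightedRelabel f c := by
  have hcol (j : ι) : ∃ x, ∀ y, y ≠ x → K y j = 0 := by
    by_cases hj : ∃ x, K x j ≠ 0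
    · obtain ⟨x, hx⟩ := hj
      exact ⟨x, fun y hyx => not_not.1 fun hy => hyx (hK j y x hy hx)⟩
    · push Not at hj
      exact ⟨Classical.arbitrary κ, fun y _ => hj y⟩
  choose f hf using hcol
  refine ⟨f, fun j => K (f j) j, ?_⟩
  ext x j
  rw [weightedRelabel_apply]
  split_ifs with hx
  · rw [hx]
  · exact hf j x hx

end IsColumnSparse

theorem isColumnSparse_relabel [DecidableEq κ] (f : ι → κ) : IsColumnSparse (relabel f) := by
  intro j x y hx hy
  simp only [relabel_apply, ne_eq, ite_eq_right_iff, one_ne_zero, imp_false, not_not] at hx hy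
  rw [hx, hy]

theorem isColumnSparse_weightedRelabel [Fintype ι] [DecidableEq ι] [DecidableEq κ] (f : ι → κ)
    (c : ι → ℂ) : IsColumnSparse (weightedRelabel f c) := by
  intro j x y hx hy
  simp only [weightedRelabel_apply, ne_eq, ite_eq_right_iff, Classical.not_imp] at hx hy
  rw [hx.1, hy.1]

theorem isColumnSparse_single [DecidableEq ι] [DecidableEq κ] (x : κ) (j : ι) (c : ℂ) :
    IsColumnSparse (Matrix.single x j c) := by
  intro i y z hy hz
  simp only [Matrix.single_apply, ne_eq, ite_eq_right_iff, Classical.not_imp] at hy hz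
  exact hy.1.1.symm.trans hz.1.1

variable [Fintype ι] [DecidableEq ι] [Fintype κ]

theorem isIncoherent_single (j : ι) : IsIncoherent (Matrix.single j j (1 : ℂ)) := by
  refine ⟨⟨?_, by simp⟩, ?_⟩ <;> rw [← Matrix.diagonal_single]
  · exact Matrix.PosSemidef.diagonal (Pi.single_nonneg.2 zero_le_one)
  · exact Matrix.isDiag_diagonal _

theorem isIncoherentKraus_iff {r : ℕ} {K : Fin r → Matrix κ ι ℂ} :
    IsIncoherentKraus K ↔ ∑ n, (K n)ᴴ * K n = 1 ∧ ∀ n, IsColumnSparse (K n) := by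
  refine and_congr_right fun _ => forall_congr' fun n => ⟨fun h j x y hx hy => ?_,
    fun h δ hδ => h.isDiag_conj hδ.2⟩
  by_contra hxy
  have hzero : (K n * Matrix.single j j (1 : ℂ) * (K n)ᴴ) x y = 0 :=
    h _ (isIncoherent_single j) hxy
  rw [Matrix.mul_apply, Fintype.sum_eq_single j fun i hij => by
    rw [Matrix.mul_single_apply_of_ne _ _ _ _ _ hij, zero_mul]] at hzero
  rw [Matrix.mul_single_apply_same, mul_one, Matrix.conjTranspose_apply] at hzero
  exact mul_ne_zero hx (star_ne_zero.2 hy) hzero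

theorem IsIncoherentKraus.nonempty [Nonempty ι] {r : ℕ} {K : Fin r → Matrix κ ι ℂ}
    (hK : IsIncoherentKraus K) : Nonempty κ := by
  by_contra hempty
  rw [not_nonempty_iff] at hempty
  have hzero : ∑ n, (K n)ᴴ * K n = 0 := Finset.sum_eq_zero fun n _ => by
    ext
    simp [Matrix.mul_apply]
  exact zero_ne_one (hzero.symm.trans hK.1)

theorem isICPTP_of_isColumnSparse {ν : Type*} [Fintype ν] {K : ν → Matrix κ ι ℂ}
    (hsum : ∑ n, (K n)ᴴ * K n = 1) (hK : ∀ n, IsColumnSparse (K n)) :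
    IsICPTP fun ρ : Matrix ι ι ℂ => ∑ n, K n * ρ * (K n)ᴴ := by
  let e := (Fintype.equivFin ν).symm
  exact ⟨Fintype.card ν, K ∘ e,
    isIncoherentKraus_iff.2 ⟨(e.sum_comp fun n => (K n)ᴴ * K n).trans hsum, fun n => hK _⟩,
    fun ρ => (e.sum_comp fun n => K n * ρ * (K n)ᴴ).symm⟩

theorem isDiag_sum {n : Type*} {R : Type*} [AddCommMonoid R] {ν : Type*} {s : Finset ν}
    {A : ν → Matrix n n R} (hA : ∀ k ∈ s, (A k).IsDiag) : (∑ k ∈ s, A k).IsDiag := by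
  intro x y hxy
  rw [Matrix.sum_apply]
  exact Finset.sum_eq_zero fun k hk => hA k hk hxy

namespace IsICPTP

variable {Φ : Matrix ι ι ℂ → Matrix κ κ ℂ} {ρ : Matrix ι ι ℂ}

theorem map_smul (hΦ : IsICPTP Φ) (c : ℝ) (ρ : Matrix ι ι ℂ) : Φ (c • ρ) = c • Φ ρ := by
  obtain ⟨r, K, -, h⟩ := hΦ
  simp only [h, Matrix.mul_smul, Matrix.smul_mul, Finset.smul_sum]

theorem posSemidef (hΦ : IsICPTP Φ) (hρ : ρ.PosSemidef) : (Φ ρ).PosSemidef := by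
  obtain ⟨r, K, -, h⟩ := hΦ
  rw [h]
  exact Matrix.posSemidef_sum _ fun n _ => hρ.mul_mul_conjTranspose_same (K n)

theorem isDiag (hΦ : IsICPTP Φ) (hρ : ρ.IsDiag) : (Φ ρ).IsDiag := by
  obtain ⟨r, K, hK, h⟩ := hΦ
  rw [h]
  exact isDiag_sum fun n _ => ((isIncoherentKraus_iff.1 hK).2 n).isDiag_conj hρ

end IsICPTP

end IsColumnSparse

section Proj

variable {ι κ : Type}

theorem posSemidef_proj [Finite ι] (ψ : ι → ℂ) : (proj ψ).PosSemidef :=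
  Matrix.posSemidef_vecMulVec_self_star ψ

theorem proj_apply (ψ : ι → ℂ) (i j : ι) : proj ψ i j = ψ i * star (ψ j) := rfl

theorem conj_proj [Fintype ι] (K : Matrix κ ι ℂ) (ψ : ι → ℂ) : K * proj ψ * Kᴴ = proj (K *ᵥ ψ) := by
  rw [proj, proj, Matrix.mul_vecMulVec, Matrix.vecMulVec_mul, Matrix.star_mulVec]

theorem proj_smul (c : ℂ) (ψ : ι → ℂ) : proj (c • ψ) = (‖c‖ ^ 2 : ℝ) • proj ψ := by
  ext x y
  simp only [proj_apply, Pi.smul_apply, smul_eq_mul, star_mul', Matrix.smul_apply,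
    Complex.real_smul]
  rw [mul_mul_mul_comm, Complex.star_def, Complex.mul_conj', Complex.ofReal_pow]

theorem continuous_proj : Continuous (proj : (ι → ℂ) → Matrix ι ι ℂ) :=
  continuous_matrix fun a b => by simp only [proj_apply]; fun_prop

end Proj

/-! ### Partial traces -/

section Composite

variable {I : Type} [Fintype I] [DecidableEq I] {τ : I → Type} [∀ i, DecidableEq (τ i)]

theorem onFactor_apply_ne_zero_iff {i : I} {B : Matrix (τ i) (τ i) ℂ} {x y : ∀ j, τ j} :
    onFactor i B x y ≠ 0 ↔ (∀ j, j ≠ i → x j = y j) ∧ B (x i) (y i) ≠ 0 := by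
  simp [onFactor]

theorem isDiag_onFactor {i : I} {B : Matrix (τ i) (τ i) ℂ} (hB : B.IsDiag) :
    (onFactor i B).IsDiag := by
  intro x y hxy
  by_contra hne
  obtain ⟨hoff, hi⟩ := onFactor_apply_ne_zero_iff.1 hne
  refine hxy (funext fun j => ?_)
  by_cases hj : j = i
  · rw [hj]
    exact not_not.1 fun h => hi (hB h)
  · exact hoff j hj

theorem onFactor_submatrix {τ' : I → Type} [∀ i, DecidableEq (τ' i)] {w : ∀ j, τ' j → τ j}
    (hw : ∀ j, Function.Injective (w j)) (i : I) (B : Matrix (τ i) (τ i) ℂ) :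
    (onFactor i B).submatrix (fun x j => w j (x j)) (fun x j => w j (x j)) =
      onFactor i (B.submatrix (w i) (w i)) := by
  ext x y
  simp only [onFactor, Matrix.submatrix_apply, Matrix.of_apply, (hw _).eq_iff]

theorem onFactor_submatrix_of_agree {α : Type*} {i : I} {f : α → ∀ j, τ j}
    (hf : ∀ x y j, j ≠ i → f x j = f y j) (B : Matrix (τ i) (τ i) ℂ) :
    (onFactor i B).submatrix f f = B.submatrix (f · i) (f · i) := by
  ext x y
  simp only [onFactor, Matrix.submatrix_apply, Matrix.of_apply]
  exact if_pos (hf x y)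

variable [∀ i, Fintype (τ i)]

theorem sum_ite_agree {E : Type*} [AddCommMonoid E] (i : I) (x : ∀ j, τ j)
    (f : (∀ j, τ j) → E) :
    ∑ z, (if ∀ j, j ≠ i → x j = z j then f z else 0) = ∑ c, f (Function.update x i c) := by
  have hupdate (z : ∀ j, τ j) : (∀ j, j ≠ i → x j = z j) ↔ Function.update x i (z i) = z := by
    rw [Function.update_eq_iff]
    exact ⟨fun h => ⟨rfl, h⟩, And.right⟩
  simp only [hupdate]
  rw [← Finset.sum_filter]
  refine Finset.sum_bij' (fun z _ => z i) (fun c _ => Function.update x i c)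
    (fun _ _ => Finset.mem_univ _) (fun c _ => ?_) (fun z hz => (Finset.mem_filter.1 hz).2)
    (fun c _ => Function.update_self i c x) (fun z hz => congrArg f (Finset.mem_filter.1 hz).2.symm)
  simp

theorem onFactor_mul (i : I) (A B : Matrix (τ i) (τ i) ℂ) :
    onFactor i A * onFactor i B = onFactor i (A * B) := by
  ext x y
  have hoff (c : τ i) :
      (∀ j, j ≠ i → Function.update x i c j = y j) ↔ ∀ j, j ≠ i → x j = y j :=
    forall_congr' fun j => imp_congr_right fun hj => by rw [Function.update_of_ne hj]
  simp only [Matrix.mul_apply, onFactor, Matrix.of_apply, ite_mul, zero_mul]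
  rw [sum_ite_agree]
  simp only [Function.update_self, hoff]
  split_ifs with h
  · rfl
  · simp only [mul_zero, Finset.sum_const_zero]

theorem trace_reduceTo_mul (i : I) (σ : Matrix (∀ j, τ j) (∀ j, τ j) ℂ)
    (B : Matrix (τ i) (τ i) ℂ) : (reduceTo i σ * B).trace = (σ * onFactor i B).trace := by
  have hright (z : ∀ j, τ j) :
      (σ * onFactor i B) z z = ∑ b, σ z (Function.update z i b) * B b (z i) := by
    have h := sum_ite_agree i z fun y => σ z y * B (y i) (z i)
    simp only [Function.update_self] at h
    simp only [Matrix.mul_apply, onFactor, Matrix.of_apply, mul_ite, mul_zero, ← h, eq_comm]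
  calc (reduceTo i σ * B).trace
      = ∑ a, ∑ z : ∀ j, τ j, if z i = a then
          ∑ b, σ z (Function.update z i b) * B b (z i) else 0 := by
        refine Finset.sum_congr rfl fun a _ => ?_
        simp only [Matrix.diag_apply, Matrix.mul_apply, reduceTo, Matrix.of_apply, Finset.sum_mul]
        rw [Finset.sum_comm]
        refine Finset.sum_congr rfl fun z _ => ?_
        split_ifs with h
        · rw [h]
        · simp only [zero_mul, Finset.sum_const_zero]
    _ = ∑ z : ∀ j, τ j, ∑ b, σ z (Function.update z i b) * B b (z i) := by
        rw [Finset.sum_comm]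
        simp only [Finset.sum_ite_eq, Finset.mem_univ, if_true]
    _ = (σ * onFactor i B).trace := Finset.sum_congr rfl fun z _ => (hright z).symm

theorem reduceTo_sum (i : I) {ν : Type*} (s : Finset ν)
    (σ : ν → Matrix (∀ j, τ j) (∀ j, τ j) ℂ) :
    reduceTo i (∑ n ∈ s, σ n) = ∑ n ∈ s, reduceTo i (σ n) := by
  rw [Matrix.ext_iff_trace_mul_right]
  intro B
  simp only [Matrix.sum_mul, Matrix.trace_sum, trace_reduceTo_mul]

theorem reduceTo_smul (i : I) (c : ℝ) (σ : Matrix (∀ j, τ j) (∀ j, τ j) ℂ) :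
    reduceTo i (c • σ) = c • reduceTo i σ := by
  rw [Matrix.ext_iff_trace_mul_right]
  intro B
  simp only [Matrix.smul_mul, Matrix.trace_smul, trace_reduceTo_mul]

theorem continuous_reduceTo (i : I) :
    Continuous (reduceTo i : Matrix (∀ j, τ j) (∀ j, τ j) ℂ → Matrix (τ i) (τ i) ℂ) := by
  refine continuous_matrix fun a b => continuous_finsetSum _ fun z _ => ?_
  split_ifs <;> fun_prop

theorem posSemidef_reduceTo (i : I) {σ : Matrix (∀ j, τ j) (∀ j, τ j) ℂ} (hσ : σ.PosSemidef) :
    (reduceTo i σ).PosSemidef := by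
  rcases isEmpty_or_nonempty (τ i) with hempty | ⟨⟨c⟩⟩
  · rw [Subsingleton.elim (reduceTo i σ) 0]
    exact Matrix.PosSemidef.zero
  have hsum : reduceTo i σ = ∑ s : ∀ j, τ j with s i = c,
      σ.submatrix (Function.update s i) (Function.update s i) := by
    ext a b
    simp only [reduceTo, Matrix.of_apply, Matrix.sum_apply, Matrix.submatrix_apply]
    rw [← Finset.sum_filter]
    refine Finset.sum_bij' (fun z _ => Function.update z i c) (fun s _ => Function.update s i a)
      (by simp) (by simp) ?_ ?_ ?_ <;>
    · simp only [Finset.mem_filter, Finset.mem_univ, true_and]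
      rintro x rfl
      simp
  rw [hsum]
  exact Matrix.posSemidef_sum _ fun s _ => hσ.submatrix _

theorem isDiag_reduceTo {i : I} {σ : Matrix (∀ j, τ j) (∀ j, τ j) ℂ}
    (hσ : ∀ x y, x i ≠ y i → σ x y = 0) : (reduceTo i σ).IsDiag := by
  intro a b hab
  refine Finset.sum_eq_zero fun z _ => ?_
  split_ifs with hz
  · exact hσ _ _ (by rwa [hz, Function.update_self])
  · rfl

theorem trace_reduceTo_relabel_conj_mul {α : Type} [Fintype α] (i : I) (f : α → ∀ j, τ j)
    (σ : Matrix α α ℂ) (B : Matrix (τ i) (τ i) ℂ) :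
    (reduceTo i (relabel f * σ * (relabel f)ᴴ) * B).trace =
      (σ * (onFactor i B).submatrix f f).trace := by
  rw [trace_reduceTo_mul, trace_relabel_conj_mul]

theorem reduceTo_relabel_conj {τ' : I → Type} [∀ i, Fintype (τ' i)] [∀ i, DecidableEq (τ' i)]
    {w : ∀ j, τ' j → τ j} (hw : ∀ j, Function.Injective (w j)) (i : I)
    (σ : Matrix (∀ j, τ' j) (∀ j, τ' j) ℂ) :
    reduceTo i (relabel (fun (x : ∀ j, τ' j) j => w j (x j)) * σ *
      (relabel (fun (x : ∀ j, τ' j) j => w j (x j)))ᴴ) =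
      relabel (w i) * reduceTo i σ * (relabel (w i))ᴴ := by
  rw [Matrix.ext_iff_trace_mul_right]
  intro B
  rw [trace_reduceTo_relabel_conj_mul, onFactor_submatrix hw, ← trace_reduceTo_mul,
    trace_relabel_conj_mul]

theorem reduceTo_relabel_conj_of_agree {α : Type} [Fintype α] {i : I} {f : α → ∀ j, τ j}
    (hf : ∀ x y j, j ≠ i → f x j = f y j) (σ : Matrix α α ℂ) :
    reduceTo i (relabel f * σ * (relabel f)ᴴ) =
      relabel (f · i) * σ * (relabel (f · i))ᴴ := by
  rw [Matrix.ext_iff_trace_mul_right]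
  intro B
  rw [trace_reduceTo_relabel_conj_mul, onFactor_submatrix_of_agree hf, trace_relabel_conj_mul]

end Composite

/-! ### The objective as a function of the states of the collections -/

theorem sum_kronecker_one {ν α β : Type*} [DecidableEq β] (s : Finset ν) (A : ν → Matrix α α ℂ) :
    (∑ n ∈ s, A n) ⊗ₖ (1 : Matrix β β ℂ) = ∑ n ∈ s, A n ⊗ₖ (1 : Matrix β β ℂ) := by
  ext x y
  simp only [Matrix.kroneckerMap_apply, Matrix.sum_apply, Finset.sum_mul]

theorem kronecker_one_submatrix {α β γ : Type*} [DecidableEq α] [DecidableEq β] {e : α → β}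
    (he : Function.Injective e) (A : Matrix γ γ ℂ) :
    (A ⊗ₖ (1 : Matrix β β ℂ)).submatrix (Prod.map id e) (Prod.map id e) = A ⊗ₖ 1 := by
  ext x y
  simp [Matrix.one_apply, he.eq_iff]

namespace Setup

variable {M N : ℕ} (S : Setup M N)

/-- The Hamiltonian `∑ₖ h^(i,k)` on the particles of collection `i`, without the ancillas. -/
def hamiltonian (i : Fin M) :
    Matrix (∀ k : Fin N, Fin (S.dim i k)) (∀ k : Fin N, Fin (S.dim i k)) ℂ :=
  ∑ k, onFactor (τ := fun k => Fin (S.dim i k)) k (S.h i k)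

/-- The energy of the basis state `p` of the particles of collection `i`. -/
def energy (i : Fin M) (p : ∀ k : Fin N, Fin (S.dim i k)) : ℂ := ∑ k, S.h i k (p k) (p k)

/-- The operator `∑_{k ≠ l} D₊^(i,k) D₋^(i,l)` on the particles of collection `i`, without the
ancillas. -/
def exchange (i : Fin M) :
    Matrix (∀ k : Fin N, Fin (S.dim i k)) (∀ k : Fin N, Fin (S.dim i k)) ℂ :=
  ∑ k, ∑ l, if k ≠ l then
    onFactor (τ := fun k => Fin (S.dim i k)) k (Matrix.single (S.e i k) (S.g i k) 1) *
      onFactor (τ := fun k => Fin (S.dim i k)) l (Matrix.single (S.g i l) (S.e i l) 1) else 0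

/-- The contribution of collection `i` to the objective, as a function of its state. -/
def cellValue (a : Fin M → ℕ) (i : Fin M) (ρ : Matrix (S.Cell a i) (S.Cell a i) ℂ) : ℝ :=
  1 / 4 * qfi ρ (S.hamiltonian i ⊗ₖ (1 : Matrix (Fin (a i)) (Fin (a i)) ℂ)) +
    (ρ * S.exchange i ⊗ₖ (1 : Matrix (Fin (a i)) (Fin (a i)) ℂ)).trace.re

theorem signal_eq_hamiltonian_kronecker_one (a : Fin M → ℕ) (i : Fin M) :
    S.signal a i = S.hamiltonian i ⊗ₖ (1 : Matrix (Fin (a i)) (Fin (a i)) ℂ) := by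
  rw [hamiltonian, sum_kronecker_one]
  rfl

theorem superradiance_eq_re_trace_reduceTo_mul (a : Fin M → ℕ) (i : Fin M)
    (σ : Matrix (S.Out a) (S.Out a) ℂ) :
    S.superradiance a i σ = (reduceTo (τ := S.Cell a) i σ *
      S.exchange i ⊗ₖ (1 : Matrix (Fin (a i)) (Fin (a i)) ℂ)).trace.re := by
  rw [superradiance, exchange, sum_kronecker_one, Matrix.mul_sum, Matrix.trace_sum]
  congr 1
  refine Finset.sum_congr rfl fun k _ => ?_
  rw [sum_kronecker_one, Matrix.mul_sum, Matrix.trace_sum]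
  refine Finset.sum_congr rfl fun l _ => ?_
  split_ifs
  · rw [trace_reduceTo_mul, raising, lowering, Matrix.mul_assoc, onFactor_mul, onParticle,
      onParticle, ← Matrix.mul_kronecker_mul, Matrix.mul_one]
  · rw [Matrix.zero_kronecker, Matrix.mul_zero, Matrix.trace_zero]

theorem objective_eq_sum_cellValue (a : Fin M → ℕ) (σ : Matrix (S.Out a) (S.Out a) ℂ) :
    S.objective a σ = ∑ i, S.cellValue a i (reduceTo (τ := S.Cell a) i σ) := by
  simp only [objective, superradiance_eq_re_trace_reduceTo_mul,
    signal_eq_hamiltonian_kronecker_one, cellValue]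

theorem hamiltonian_eq_diagonal (i : Fin M) :
    S.hamiltonian i = Matrix.diagonal (S.energy i) := by
  have hdiag : (S.hamiltonian i).IsDiag :=
    isDiag_sum fun k _ => isDiag_onFactor (τ := fun k => Fin (S.dim i k)) (S.h_isDiag i k)
  rw [← hdiag.diagonal_diag]
  congr 1
  ext p
  simp [hamiltonian, energy, Matrix.sum_apply, onFactor]

theorem hamiltonian_kronecker_one_eq_diagonal (i : Fin M) (b : ℕ) :
    S.hamiltonian i ⊗ₖ (1 : Matrix (Fin b) (Fin b) ℂ) =
      Matrix.diagonal fun x => S.energy i x.1 := by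
  rw [hamiltonian_eq_diagonal, ← Matrix.diagonal_one, Matrix.diagonal_kronecker_diagonal]
  simp only [mul_one]

theorem exchange_apply_eq_zero (i : Fin M) {p q : ∀ k : Fin N, Fin (S.dim i k)}
    (h : ∀ k l, k ≠ l → p k = q k ∨ p l = q l) : S.exchange i p q = 0 := by
  simp only [exchange, Matrix.sum_apply]
  refine Finset.sum_eq_zero fun k _ => Finset.sum_eq_zero fun l _ => ?_
  split_ifs with hkl
  swap
  · rfl
  refine Finset.sum_eq_zero fun z _ => ?_
  by_contra hne
  obtain ⟨hpz, hk⟩ := onFactor_apply_ne_zero_iff.1 (left_ne_zero_of_mul hne)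
  obtain ⟨hzq, hl⟩ := onFactor_apply_ne_zero_iff.1 (right_ne_zero_of_mul hne)
  simp only [Matrix.single_apply, ne_eq, ite_eq_right_iff, one_ne_zero, imp_false,
    not_not] at hk hl
  rcases h k l hkl with hpq | hpq
  · exact S.g_ne_e i k (by rw [hk.1, hk.2, hpq, hzq k hkl])
  · exact S.g_ne_e i l (by rw [hl.1, hl.2, ← hpq, hpz l hkl.symm])

theorem trace_mul_exchange_eq_zero (a : Fin M → ℕ) (i : Fin M)
    {ρ : Matrix (S.Cell a i) (S.Cell a i) ℂ}
    (h : ∀ x y, ρ x y ≠ 0 → ∀ k l, k ≠ l → x.1 k = y.1 k ∨ x.1 l = y.1 l) :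
    (ρ * S.exchange i ⊗ₖ (1 : Matrix (Fin (a i)) (Fin (a i)) ℂ)).trace = 0 := by
  simp only [Matrix.trace, Matrix.diag_apply, Matrix.mul_apply, Matrix.kroneckerMap_apply]
  refine Finset.sum_eq_zero fun x _ => Finset.sum_eq_zero fun y _ => ?_
  by_cases hxy : ρ x y = 0
  · rw [hxy, zero_mul]
  · rw [S.exchange_apply_eq_zero i fun k l hkl => (h x y hxy k l hkl).imp Eq.symm Eq.symm,
      zero_mul, mul_zero]

theorem cellValue_sum_le {ν : Type*} (s : Finset ν) (a : Fin M → ℕ) (i : Fin M)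
    {ρ : ν → Matrix (S.Cell a i) (S.Cell a i) ℂ} (hρ : ∀ n ∈ s, (ρ n).PosSemidef) :
    S.cellValue a i (∑ n ∈ s, ρ n) ≤ ∑ n ∈ s, S.cellValue a i (ρ n) := by
  simp only [cellValue, Finset.sum_add_distrib, Matrix.sum_mul, Matrix.trace_sum, Complex.re_sum,
    ← Finset.mul_sum]
  gcongr
  exact qfi_sum_le s hρ _

theorem objective_sum_le {ν : Type*} (s : Finset ν) (a : Fin M → ℕ)
    {σ : ν → Matrix (S.Out a) (S.Out a) ℂ} (hσ : ∀ n ∈ s, (σ n).PosSemidef) :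
    S.objective a (∑ n ∈ s, σ n) ≤ ∑ n ∈ s, S.objective a (σ n) := by
  simp only [objective_eq_sum_cellValue]
  rw [Finset.sum_comm]
  refine Finset.sum_le_sum fun i _ => ?_
  rw [reduceTo_sum]
  exact S.cellValue_sum_le s a i fun n hn => posSemidef_reduceTo i (hσ n hn)

theorem objective_smul (a : Fin M → ℕ) {σ : Matrix (S.Out a) (S.Out a) ℂ} (hσ : σ.PosSemidef)
    {c : ℝ} (hc : 0 ≤ c) : S.objective a (c • σ) = c * S.objective a σ := by
  simp only [objective_eq_sum_cellValue, Finset.mul_sum]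
  refine Finset.sum_congr rfl fun i _ => ?_
  rw [reduceTo_smul, cellValue, cellValue, qfi_smul (posSemidef_reduceTo i hσ) _ hc,
    Matrix.smul_mul, Matrix.trace_smul, Complex.smul_re, smul_eq_mul]
  ring

theorem continuousOn_objective (a : Fin M → ℕ) :
    ContinuousOn (S.objective a) {σ | σ.PosSemidef} := by
  rw [funext (S.objective_eq_sum_cellValue a)]
  refine continuousOn_finsetSum _ fun i _ => ?_
  have hreduce := continuous_reduceTo (τ := S.Cell a) i
  exact (((continuousOn_qfi _).comp hreduce.continuousOn
    fun σ hσ => posSemidef_reduceTo i hσ).const_mul _).add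
    (Continuous.continuousOn (by fun_prop))

theorem cellValue_eq_zero_of_isDiag (a : Fin M → ℕ) (i : Fin M)
    {ρ : Matrix (S.Cell a i) (S.Cell a i) ℂ} (hρ : ρ.PosSemidef) (hdiag : ρ.IsDiag) :
    S.cellValue a i ρ = 0 := by
  have hcommute : Commute ρ (S.hamiltonian i ⊗ₖ (1 : Matrix (Fin (a i)) (Fin (a i)) ℂ)) := by
    rw [hamiltonian_kronecker_one_eq_diagonal, ← hdiag.diagonal_diag]
    exact Matrix.commute_diagonal _ _
  rw [cellValue, (qfi_eq_zero_iff_commute hρ).2 hcommute, S.trace_mul_exchange_eq_zero a i]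
  · simp
  · intro x y hxy k l _
    rw [not_imp_comm.1 (@hdiag x y) hxy]
    exact Or.inl rfl

theorem objective_eq_zero_of_isDiag (a : Fin M → ℕ) {σ : Matrix (S.Out a) (S.Out a) ℂ}
    (hσ : σ.PosSemidef) (hdiag : σ.IsDiag) : S.objective a σ = 0 := by
  rw [objective_eq_sum_cellValue]
  exact Finset.sum_eq_zero fun i _ => S.cellValue_eq_zero_of_isDiag a i (posSemidef_reduceTo i hσ)
    (isDiag_reduceTo fun x y hxy => hdiag fun h => hxy (congrFun h i))

/-- The map between the basis labels of output systems that is induced by maps `e i` between the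
ancillary basis labels. -/
def embed {a b : Fin M → ℕ} (e : ∀ i, Fin (a i) → Fin (b i)) (x : S.Out a) : S.Out b :=
  fun i => Prod.map id (e i) (x i)

theorem embed_injective {a b : Fin M → ℕ} {e : ∀ i, Fin (a i) → Fin (b i)}
    (he : ∀ i, Function.Injective (e i)) : Function.Injective (S.embed e) := fun _ _ h =>
  funext fun i => Function.injective_id.prodMap (he i) (congrFun h i)

theorem objective_directSum {ν : Type*} [Fintype ν] {a : ν → Fin M → ℕ} {b : Fin M → ℕ}
    {e : ∀ n i, Fin (a n i) → Fin (b i)} (he : ∀ n i, Function.Injective (e n i))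
    (hdisj : ∀ n m i x y, n ≠ m → e n i x ≠ e m i y)
    {σ : ∀ n, Matrix (S.Out (a n)) (S.Out (a n)) ℂ} (hσ : ∀ n, (σ n).PosSemidef) :
    S.objective b (∑ n, relabel (S.embed (e n)) * σ n * (relabel (S.embed (e n)))ᴴ) =
      ∑ n, S.objective (a n) (σ n) := by
  simp only [objective_eq_sum_cellValue]
  rw [Finset.sum_comm]
  refine Finset.sum_congr rfl fun i _ => ?_
  let w (n : ν) (j : Fin M) : S.Cell (a n) j → S.Cell b j := Prod.map id (e n j)
  have hw (n : ν) (j : Fin M) : Function.Injective (w n j) :=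
    Function.injective_id.prodMap (he n j)
  have hreduce (n : ν) : reduceTo (τ := S.Cell b) i
      (relabel (S.embed (e n)) * σ n * (relabel (S.embed (e n)))ᴴ) =
      relabel (w n i) * reduceTo (τ := S.Cell (a n)) i (σ n) * (relabel (w n i))ᴴ :=
    reduceTo_relabel_conj (τ := S.Cell b) (τ' := S.Cell (a n)) (hw n) i (σ n)
  rw [reduceTo_sum]
  simp only [hreduce, cellValue, Finset.sum_add_distrib, ← Finset.mul_sum]
  congr 1
  · rw [qfi_directSum (γ := fun n => S.Cell (a n) i)
      (fun n => conjTranspose_relabel_mul_self (hw n i))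
      (fun n m hnm => conjTranspose_relabel_mul_of_ne fun x y h =>
        hdisj n m i x.2 y.2 hnm (congrArg Prod.snd h))
      (fun n => kronecker_one_mul_relabel (e n i) (S.hamiltonian i))
      (fun n => conjTranspose_relabel_mul_kronecker_one (e n i) (S.hamiltonian i))
      (fun n => posSemidef_reduceTo i (hσ n))]
  · rw [Matrix.sum_mul, Matrix.trace_sum, Complex.re_sum]
    refine Finset.sum_congr rfl fun n _ => ?_
    rw [trace_relabel_conj_mul, kronecker_one_submatrix (he n i)]

end Setup

/-! ### The maximum over incoherent operations -/

section IsPure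

variable {ι : Type} [Fintype ι]

theorem isPure_iff_norm_toLp (c : ι → ℂ) : IsPure c ↔ ‖WithLp.toLp 2 c‖ = 1 := by
  rw [EuclideanSpace.norm_eq, Real.sqrt_eq_one]
  rfl

theorem isCompact_setOf_isPure : IsCompact {c : ι → ℂ | IsPure c} := by
  convert (isCompact_sphere (0 : EuclideanSpace ℂ ι) 1).image (PiLp.continuous_ofLp 2 _) using 1
  ext c
  refine ⟨fun hc => ⟨WithLp.toLp 2 c, by simpa using (isPure_iff_norm_toLp c).1 hc, rfl⟩, ?_⟩
  rintro ⟨c, hc, rfl⟩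
  exact (isPure_iff_norm_toLp _).2 (by simpa using hc)

theorem isPure_single [DecidableEq ι] (j : ι) : IsPure (Pi.single j (1 : ℂ)) := by
  simp [IsPure, Pi.single_apply, apply_ite norm, ite_pow]

theorem exists_isPure_smul [Nonempty ι] (c : ι → ℂ) :
    ∃ (s : ℂ) (u : ι → ℂ), IsPure u ∧ c = s • u := by
  classical
  rcases eq_or_ne c 0 with rfl | hc
  · exact ⟨0, _, isPure_single (Classical.arbitrary ι), (zero_smul _ _).symm⟩
  have hnorm : ‖WithLp.toLp 2 c‖ ≠ 0 := by simpa using hc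
  refine ⟨(‖WithLp.toLp 2 c‖ : ℂ), (‖WithLp.toLp 2 c‖ : ℂ)⁻¹ • c, ?_, ?_⟩
  · rw [isPure_iff_norm_toLp, WithLp.toLp_smul, norm_smul, norm_inv, Complex.norm_real, norm_norm,
      inv_mul_cancel₀ hnorm]
  · rw [smul_inv_smul₀ (by exact_mod_cast hnorm)]

theorem norm_ofReal_sqrt_sq {w : ℝ} (hw : 0 ≤ w) : ‖((√w : ℝ) : ℂ)‖ ^ 2 = w := by
  rw [Complex.norm_real, Real.norm_eq_abs, sq_abs, Real.sq_sqrt hw]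

end IsPure

theorem exists_disjoint_injective {ν : Type*} [Finite ν] (a : ν → ℕ) :
    ∃ (b : ℕ) (e : ∀ n, Fin (a n) → Fin b),
      (∀ n, Function.Injective (e n)) ∧ ∀ n m x y, n ≠ m → e n x ≠ e m y := by
  have := Fintype.ofFinite ν
  refine ⟨_, fun n x => Fintype.equivFin (Σ n, Fin (a n)) ⟨n, x⟩, fun n => ?_, ?_⟩
  · exact (Fintype.equivFin _).injective.comp sigma_mk_injective
  · exact fun n m x y hnm h => hnm (congrArg Sigma.fst ((Fintype.equivFin _).injective h))

theorem exists_factorization_through_fin {ι : Type*} [Fintype ι] {b : ℕ} (f : ι → Fin b) :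
    ∃ (d : Fin (Fintype.card ι + 1)) (e : Fin d → Fin b) (g : ι → Fin d),
      Function.Injective e ∧ f = e ∘ g := by
  classical
  let s := Finset.univ.image f
  refine ⟨⟨s.card, Nat.lt_succ_of_le Finset.card_image_le⟩, fun x => (s.equivFin.symm x).1,
    fun j => s.equivFin ⟨f j, Finset.mem_image_of_mem _ (Finset.mem_univ j)⟩,
    Subtype.val_injective.comp s.equivFin.symm.injective, ?_⟩
  ext j
  simp

theorem continuous_uncurry_of_discrete {X Y Z T : Type*} [TopologicalSpace X] [TopologicalSpace Y]
    [TopologicalSpace Z] [TopologicalSpace T] [DiscreteTopology T] {f : Y → T × X → Z}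
    (hf : ∀ t, Continuous fun q : Y × X => f q.1 (t, q.2)) : Continuous f.uncurry := by
  have h : Continuous fun q : T × Y × X => f q.2.1 (q.1, q.2.2) :=
    continuous_prod_of_discrete_left.2 hf
  exact h.comp (by fun_prop : Continuous fun q : Y × T × X => (q.2.1, q.1, q.2.2))

namespace Setup

variable {M N : ℕ} (S : Setup M N) {ι : Type} [Fintype ι] [DecidableEq ι]

/-- The labels `n` of the branches can be recorded as classical flags in the ancillas of every
collection. -/
theorem sum_objective_mem_pureValues {ν : Type*} [Fintype ν] {μ : ν → Type*} [∀ n, Fintype (μ n)]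
    (a : ν → Fin M → ℕ) (L : ∀ n, μ n → Matrix (S.Out (a n)) ι ℂ)
    (hL : ∀ n m, IsColumnSparse (L n m)) (hsum : ∑ n, ∑ m, (L n m)ᴴ * L n m = 1) (ψ : ι → ℂ) :
    ∑ n, S.objective (a n) (∑ m, proj (L n m *ᵥ ψ)) ∈ S.pureValues ψ := by
  choose b e he hdisj using fun i => exists_disjoint_injective fun n => a n i
  let V (n : ν) : Matrix (S.Out b) (S.Out (a n)) ℂ := relabel (S.embed fun i => e i n)
  have hV (n : ν) : (V n)ᴴ * V n = 1 :=
    conjTranspose_relabel_mul_self (S.embed_injective fun i => he i n)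
  let K (q : Σ n, μ n) : Matrix (S.Out b) ι ℂ := V q.1 * L q.1 q.2
  have hK : ∑ q, (K q)ᴴ * K q = 1 := by
    rw [← hsum, Fintype.sum_sigma]
    refine Finset.sum_congr rfl fun n _ => Finset.sum_congr rfl fun m _ => ?_
    rw [Matrix.conjTranspose_mul, Matrix.mul_assoc, ← Matrix.mul_assoc (V n)ᴴ, hV, Matrix.one_mul]
  have hout : ∑ q, K q * proj ψ * (K q)ᴴ = ∑ n, V n * (∑ m, proj (L n m *ᵥ ψ)) * (V n)ᴴ := by
    simp only [Fintype.sum_sigma, Matrix.mul_sum, Matrix.sum_mul, conj_proj, Matrix.mulVec_mulVec,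
      K]
  refine ⟨b, _, isICPTP_of_isColumnSparse hK fun q => (isColumnSparse_relabel _).mul (hL _ _), ?_⟩
  rw [hout]
  exact (S.objective_directSum (fun n i => he i n) (fun n m i => hdisj i n m)
    fun n => Matrix.posSemidef_sum _ fun m _ => posSemidef_proj _).symm

/-- The form of an incoherent Kraus operator up to relabelling of the ancillas: how many ancillary
basis states of each collection it reaches, and the image of each basis vector. There are finitely
many patterns. -/
abbrev Pattern (ι : Type) [Fintype ι] : Type :=
  Σ d : Fin M → Fin (Fintype.card ι + 1), ι → S.Out fun i => (d i : ℕ)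

/-- A pattern with weights, which encodes a Kraus operator. -/
abbrev Branch (ι : Type) [Fintype ι] : Type := S.Pattern ι × (ι → ℂ)

/-- The contribution `K† K` of a branch with Kraus operator `K` to the completeness relation. -/
def effect (q : S.Branch ι) : Matrix ι ι ℂ :=
  (weightedRelabel q.1.2 q.2)ᴴ * weightedRelabel q.1.2 q.2

/-- The objective after a branch acting on `ψ`, without normalization. -/
def branchValue (ψ : ι → ℂ) (q : S.Branch ι) : ℝ :=
  S.objective (fun i => (q.1.1 i : ℕ)) (proj (weightedRelabel q.1.2 q.2 *ᵥ ψ))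

theorem effect_smul (t : S.Pattern ι) (s : ℂ) (c : ι → ℂ) :
    S.effect (t, s • c) = (‖s‖ ^ 2 : ℝ) • S.effect (t, c) := by
  rw [effect, weightedRelabel_smul, Matrix.conjTranspose_smul, Matrix.smul_mul, Matrix.mul_smul,
    smul_smul, Complex.star_def, Complex.conj_mul', ← Complex.ofReal_pow, ← Complex.coe_smul]
  rfl

theorem branchValue_smul (ψ : ι → ℂ) (t : S.Pattern ι) (s : ℂ) (c : ι → ℂ) :
    S.branchValue ψ (t, s • c) = ‖s‖ ^ 2 * S.branchValue ψ (t, c) := by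
  rw [branchValue, weightedRelabel_smul, Matrix.smul_mulVec, proj_smul,
    S.objective_smul _ (posSemidef_proj _) (sq_nonneg _)]
  rfl

theorem re_trace_effect (q : S.Branch ι) : (S.effect q).trace.re = ∑ j, ‖q.2 j‖ ^ 2 :=
  trace_conjTranspose_weightedRelabel_mul_self _ _

theorem continuous_effect : Continuous (S.effect : S.Branch ι → Matrix ι ι ℂ) :=
  continuous_prod_of_discrete_left.2 fun t =>
    (continuous_weightedRelabel t.2).matrix_conjTranspose.matrix_mul
      (continuous_weightedRelabel t.2)

theorem continuous_branchValue : Continuous (S.branchValue (ι := ι)).uncurry := by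
  refine continuous_uncurry_of_discrete fun t => ?_
  have himage : Continuous fun q : (ι → ℂ) × (ι → ℂ) => weightedRelabel t.2 q.2 *ᵥ q.1 :=
    ((continuous_weightedRelabel t.2).comp continuous_snd).matrix_mulVec continuous_fst
  exact (S.continuousOn_objective fun i => (t.1 i : ℕ)).comp_continuous
    (continuous_proj.comp himage) fun q => posSemidef_proj (weightedRelabel t.2 q.2 *ᵥ q.1)

theorem exists_branch_of_isColumnSparse [Nonempty ι] {a : Fin M → ℕ} [Nonempty (S.Out a)]
    {K : Matrix (S.Out a) ι ℂ} (hK : IsColumnSparse K) :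
    ∃ q : S.Branch ι, Kᴴ * K = S.effect q ∧
      ∀ ψ, S.objective a (proj (K *ᵥ ψ)) = S.branchValue ψ q := by
  obtain ⟨f, c, rfl⟩ := hK.exists_eq_weightedRelabel
  choose d e g he hf using fun i => exists_factorization_through_fin fun j => (f j i).2
  let t : S.Pattern ι := ⟨d, fun j i => ((f j i).1, g i j)⟩
  have hembed : weightedRelabel f c = relabel (S.embed e) * weightedRelabel t.2 c := by
    rw [relabel_mul_weightedRelabel]
    congr 1
    ext1 j
    ext1 i
    exact Prod.ext rfl (congrFun (hf i) j)
  rw [hembed]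
  refine ⟨(t, c), ?_, fun ψ => ?_⟩
  · rw [Matrix.conjTranspose_mul, Matrix.mul_assoc, ← Matrix.mul_assoc (relabel _)ᴴ,
      conjTranspose_relabel_mul_self (S.embed_injective he), Matrix.one_mul, effect]
  · have hsum := S.objective_directSum (ν := Unit) (fun _ => he)
      (fun n m _ _ _ h => absurd (Subsingleton.elim n m) h)
      fun _ => posSemidef_proj (weightedRelabel t.2 c *ᵥ ψ)
    rwa [Fintype.sum_unique, Fintype.sum_unique, conj_proj, Matrix.mulVec_mulVec] at hsum

theorem exists_isPure_branch_of_isColumnSparse [Nonempty ι] {a : Fin M → ℕ} [Nonempty (S.Out a)]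
    {K : Matrix (S.Out a) ι ℂ} (hK : IsColumnSparse K) :
    ∃ (w : ℝ) (q : S.Branch ι), 0 ≤ w ∧ IsPure q.2 ∧ Kᴴ * K = w • S.effect q ∧
      ∀ ψ, S.objective a (proj (K *ᵥ ψ)) = w * S.branchValue ψ q := by
  obtain ⟨⟨t, c⟩, heffect, hvalue⟩ := S.exists_branch_of_isColumnSparse hK
  obtain ⟨s, u, hu, rfl⟩ := exists_isPure_smul c
  exact ⟨‖s‖ ^ 2, (t, u), sq_nonneg _, hu, heffect.trans (S.effect_smul t s u),
    fun ψ => (hvalue ψ).trans (S.branchValue_smul ψ t s u)⟩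

/-- The averages of the branch values over the normalized branches whose effects average to the
maximally mixed state. The factor `(dim)⁻¹` turns the completeness relation into a convex
combination. -/
def branchAverages (ψ : ι → ℂ) : Set ℝ :=
  decompositionValues {q : S.Branch ι | IsPure q.2} S.effect (S.branchValue ψ)
    ((Fintype.card ι : ℝ)⁻¹ • 1)

omit [DecidableEq ι] in
theorem isCompact_setOf_isPure_branch : IsCompact {q : S.Branch ι | IsPure q.2} := by
  have h := (isCompact_univ (X := S.Pattern ι)).prod (isCompact_setOf_isPure (ι := ι))
  rwa [Set.univ_prod] at h

theorem exists_le_of_mem_pureValues [Nonempty ι] {ψ : ι → ℂ} {v : ℝ} (hv : v ∈ S.pureValues ψ) :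
    ∃ u ∈ S.branchAverages ψ, v ≤ Fintype.card ι * u := by
  obtain ⟨a, Φ, ⟨r, K, hK, hΦ⟩, rfl⟩ := hv
  have := hK.nonempty
  obtain ⟨hsum, hsparse⟩ := isIncoherentKraus_iff.1 hK
  choose w q hw hq heffect hvalue using
    fun n => S.exists_isPure_branch_of_isColumnSparse (hsparse n)
  simp only [heffect] at hsum
  have hcard : (Fintype.card ι : ℝ) ≠ 0 := Nat.cast_ne_zero.2 Fintype.card_ne_zero
  have htrace : ∑ n, w n = Fintype.card ι := by
    have h := congrArg (fun A => (Matrix.trace A).re) hsum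
    simp only [Matrix.trace_sum, Matrix.trace_smul, Complex.re_sum, Complex.smul_re,
      re_trace_effect, Matrix.trace_one, Complex.natCast_re] at h
    rw [← h]
    exact Finset.sum_congr rfl fun n _ => by rw [(hq n : ∑ j, _ = _), smul_eq_mul, mul_one]
  have hmem := sum_mem_decompositionValues (s := {q : S.Branch ι | IsPure q.2})
    (w := fun n => (Fintype.card ι : ℝ)⁻¹ * w n) S.effect (S.branchValue ψ)
    (fun n => mul_nonneg (by positivity) (hw n))
    (by rw [← Finset.mul_sum, htrace, inv_mul_cancel₀ hcard]) hq
  simp only [mul_smul, mul_assoc, ← Finset.smul_sum, ← Finset.mul_sum, hsum] at hmem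
  refine ⟨_, hmem, ?_⟩
  rw [mul_inv_cancel_left₀ hcard, hΦ]
  simp only [conj_proj, ← hvalue]
  exact S.objective_sum_le _ a fun n _ => posSemidef_proj _

theorem mul_mem_pureValues [Nonempty ι] {ψ : ι → ℂ} {u : ℝ} (hu : u ∈ S.branchAverages ψ) :
    Fintype.card ι * u ∈ S.pureValues ψ := by
  obtain ⟨r, ⟨w, q⟩, ⟨hw, -, -, hsum⟩, rfl⟩ := hu
  have hcard : (Fintype.card ι : ℝ) ≠ 0 := Nat.cast_ne_zero.2 Fintype.card_ne_zero
  have hweight (n : Fin r) : ‖((√(Fintype.card ι * w n) : ℝ) : ℂ)‖ ^ 2 = Fintype.card ι * w n :=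
    norm_ofReal_sqrt_sq (mul_nonneg (Nat.cast_nonneg _) (hw n))
  let c (n : Fin r) : ι → ℂ := ((√(Fintype.card ι * w n) : ℝ) : ℂ) • (q n).2
  have heffect (n : Fin r) :
      S.effect ((q n).1, c n) = (Fintype.card ι * w n : ℝ) • S.effect (q n) :=
    (S.effect_smul _ _ _).trans (by rw [hweight])
  have hvalue (n : Fin r) :
      S.branchValue ψ ((q n).1, c n) = Fintype.card ι * (w n * S.branchValue ψ (q n)) :=
    (S.branchValue_smul ψ _ _ _).trans (by rw [hweight, mul_assoc])
  have hmem := S.sum_objective_mem_pureValues (μ := fun _ : Fin r => Unit)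
    (fun n i => ((q n).1.1 i : ℕ)) (fun n _ => weightedRelabel (q n).1.2 (c n))
    (fun n _ => isColumnSparse_weightedRelabel _ _) (by
      simp only [Fintype.sum_unique]
      exact (Finset.sum_congr rfl fun n _ => heffect n).trans (by
        simp only [mul_smul, ← Finset.smul_sum]
        rw [← hsum, smul_inv_smul₀ hcard])) ψ
  simp only [Fintype.sum_unique] at hmem
  rw [average, Finset.mul_sum]
  exact (Finset.sum_congr rfl fun n _ => hvalue n) ▸ hmem

theorem zero_mem_pureValues (ψ : ι → ℂ) : 0 ∈ S.pureValues ψ := by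
  let a : Fin M → ℕ := fun _ => 1
  let x : S.Out a := fun i => (S.g i, 0)
  let K (j : ι) : Matrix (S.Out a) ι ℂ := Matrix.single x j 1
  have hsum : ∑ j, (K j)ᴴ * K j = 1 := by
    simp only [K, Matrix.conjTranspose_single, Matrix.single_mul_single_same, star_one, mul_one]
    exact Matrix.sum_single_one
  have hdiag : (∑ j, K j * proj ψ * (K j)ᴴ).IsDiag := isDiag_sum fun j _ y z hyz => by
    rw [Matrix.conjTranspose_single, Matrix.single_mul_mul_single]
    exact Matrix.single_apply_of_ne _ _ _ _ _ fun h => hyz (h.1.symm.trans h.2)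
  exact ⟨a, _, isICPTP_of_isColumnSparse hsum fun j => isColumnSparse_single x j 1,
    (S.objective_eq_zero_of_isDiag a (Matrix.posSemidef_sum _ fun j _ =>
      (posSemidef_proj ψ).mul_mul_conjTranspose_same _) hdiag).symm⟩

theorem isGreatest_pureValues [Nonempty ι] (ψ : ι → ℂ) :
    IsGreatest (S.pureValues ψ) (Fintype.card ι * sSup (S.branchAverages ψ)) := by
  have hcompact : IsCompact (S.branchAverages ψ) :=
    isCompact_decompositionValues S.isCompact_setOf_isPure_branch S.continuous_effect
      (S.continuous_branchValue.comp (by fun_prop : Continuous fun q => (ψ, q))) _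
  have hnonempty : (S.branchAverages ψ).Nonempty :=
    let ⟨u, hu, _⟩ := S.exists_le_of_mem_pureValues (S.zero_mem_pureValues ψ)
    ⟨u, hu⟩
  refine ⟨S.mul_mem_pureValues (hcompact.sSup_mem hnonempty), fun v hv => ?_⟩
  obtain ⟨u, hu, hvu⟩ := S.exists_le_of_mem_pureValues hv
  exact hvu.trans (by gcongr; exact le_csSup hcompact.bddAbove hu)

theorem isGreatest_pureCSF [Nonempty ι] (ψ : ι → ℂ) :
    IsGreatest (S.pureValues ψ) (S.pureCSF ψ) := by
  rw [pureCSF, (S.isGreatest_pureValues ψ).csSup_eq]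
  exact S.isGreatest_pureValues ψ

theorem continuous_pureCSF [Nonempty ι] : Continuous (S.pureCSF : (ι → ℂ) → ℝ) := by
  have h : S.pureCSF = fun ψ : ι → ℂ => Fintype.card ι * sSup (S.branchAverages ψ) :=
    funext fun ψ => (S.isGreatest_pureValues ψ).csSup_eq
  rw [h]
  exact continuous_const.mul (continuous_sSup_decompositionValues S.isCompact_setOf_isPure_branch
    S.continuous_effect S.continuous_branchValue _)

theorem pureCSF_nonneg [Nonempty ι] (ψ : ι → ℂ) : 0 ≤ S.pureCSF ψ :=
  (S.isGreatest_pureCSF ψ).2 (S.zero_mem_pureValues ψ)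

open scoped Pointwise in
theorem pureCSF_smul (c : ℂ) (ψ : ι → ℂ) : S.pureCSF (c • ψ) = ‖c‖ ^ 2 * S.pureCSF ψ := by
  have hscale {a : Fin M → ℕ} {Φ : Matrix ι ι ℂ → Matrix (S.Out a) (S.Out a) ℂ}
      (hΦ : IsICPTP Φ) :
      S.objective a (Φ (proj (c • ψ))) = ‖c‖ ^ 2 • S.objective a (Φ (proj ψ)) := by
    rw [proj_smul, hΦ.map_smul,
      S.objective_smul a (hΦ.posSemidef (posSemidef_proj ψ)) (sq_nonneg _), smul_eq_mul]
  have hvalues : S.pureValues (c • ψ) = ‖c‖ ^ 2 • S.pureValues ψ := by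
    ext v
    constructor
    · rintro ⟨a, Φ, hΦ, rfl⟩
      exact ⟨_, ⟨a, Φ, hΦ, rfl⟩, (hscale hΦ).symm⟩
    · rintro ⟨_, ⟨a, Φ, hΦ, rfl⟩, rfl⟩
      exact ⟨a, Φ, hΦ, (hscale hΦ).symm⟩
  rw [pureCSF, pureCSF, hvalues, Real.sSup_smul_of_nonneg (sq_nonneg _), smul_eq_mul]

/-- An optimal operation after each outcome, with the outcome recorded as a flag, is an operation
available to `ψ`. -/
theorem sum_pureCSF_le [Nonempty ι] {κ : Type} [Fintype κ] [DecidableEq κ] {r : ℕ}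
    {K : Fin r → Matrix κ ι ℂ} (hK : IsIncoherentKraus K) (ψ : ι → ℂ) :
    ∑ n, S.pureCSF (K n *ᵥ ψ) ≤ S.pureCSF ψ := by
  have := hK.nonempty
  choose a Φ hΦ hvalue using fun n => (S.isGreatest_pureCSF (K n *ᵥ ψ)).1
  choose s L hL hΦL using hΦ
  have hsum : ∑ n, ∑ m, (L n m * K n)ᴴ * (L n m * K n) = 1 := by
    have hcomp (n : Fin r) : ∑ m, (L n m * K n)ᴴ * (L n m * K n) = (K n)ᴴ * K n :=
      calc
        _ = (K n)ᴴ * (∑ m, (L n m)ᴴ * L n m) * K n := by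
          simp only [Matrix.mul_sum, Matrix.sum_mul, Matrix.conjTranspose_mul, Matrix.mul_assoc]
        _ = (K n)ᴴ * K n := by rw [(hL n).1, Matrix.mul_one]
    simp only [hcomp]
    exact hK.1
  have hmem := S.sum_objective_mem_pureValues a (fun n m => L n m * K n) (fun n m =>
    ((isIncoherentKraus_iff.1 (hL n)).2 m).mul ((isIncoherentKraus_iff.1 hK).2 n)) hsum ψ
  refine le_of_eq_of_le (Finset.sum_congr rfl fun n _ => ?_) ((S.isGreatest_pureCSF ψ).2 hmem)
  simp only [hvalue, hΦL, conj_proj, Matrix.mulVec_mulVec]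

theorem pureCSF_eq_zero_of_isDiag [Nonempty ι] {ψ : ι → ℂ} (h : (proj ψ).IsDiag) :
    S.pureCSF ψ = 0 := by
  obtain ⟨a, Φ, hΦ, hvalue⟩ := (S.isGreatest_pureCSF ψ).1
  rw [hvalue]
  exact S.objective_eq_zero_of_isDiag a (hΦ.posSemidef (posSemidef_proj ψ)) (hΦ.isDiag h)

end Setup

/-! ### Faithfulness on pure states -/

namespace Setup

variable {M N : ℕ} (S : Setup M N) {ι : Type} [Fintype ι]

theorem objective_relabel_conj_of_agree {a : Fin M → ℕ} {i : Fin M} {f : ι → S.Out a}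
    (hf : ∀ x y j, j ≠ i → f x j = f y j) {σ : Matrix ι ι ℂ} (hσ : σ.PosSemidef) :
    S.objective a (relabel f * σ * (relabel f)ᴴ) =
      S.cellValue a i (relabel (f · i) * σ * (relabel (f · i))ᴴ) := by
  rw [objective_eq_sum_cellValue, Fintype.sum_eq_single i fun j hj => ?_,
    reduceTo_relabel_conj_of_agree (τ := S.Cell a) hf]
  refine S.cellValue_eq_zero_of_isDiag a j
    (posSemidef_reduceTo j (hσ.mul_mul_conjTranspose_same _)) (isDiag_reduceTo fun x y hxy => ?_)
  by_contra hne
  obtain ⟨⟨u, rfl⟩, ⟨v, rfl⟩⟩ := mem_range_of_relabel_conj_apply_ne_zero hne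
  exact hxy (hf u v j hj)

theorem cellValue_pos (a : Fin M → ℕ) (i : Fin M) {ρ : Matrix (S.Cell a i) (S.Cell a i) ℂ}
    (hρ : ρ.PosSemidef)
    (hagree : ∀ x y, ρ x y ≠ 0 → ∀ k l, k ≠ l → x.1 k = y.1 k ∨ x.1 l = y.1 l)
    {x y : S.Cell a i} (hxy : ρ x y ≠ 0) (henergy : S.energy i x.1 ≠ S.energy i y.1) :
    0 < S.cellValue a i ρ := by
  rw [cellValue, S.trace_mul_exchange_eq_zero a i hagree, Complex.zero_re, add_zero]
  refine mul_pos (by norm_num) ((qfi_nonneg hρ _).lt_of_ne' fun hzero => ?_)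
  rw [qfi_eq_zero_iff_commute hρ, hamiltonian_kronecker_one_eq_diagonal] at hzero
  have hentry := congrFun₂ hzero.eq x y
  rw [Matrix.mul_diagonal, Matrix.diagonal_mul, mul_comm] at hentry
  exact henergy (mul_right_cancel₀ hxy hentry).symm

theorem exists_level_ne (i : Fin M) (k : Fin N) : ∃ u v, S.h i k u u ≠ S.h i k v v := by
  by_contra! h
  refine S.h_nontrivial i k (S.h i k (S.g i k) (S.g i k)) ?_
  rw [← (S.h_isDiag i k).diagonal_diag, ← Matrix.diagonal_one, ← Matrix.diagonal_smul]
  congr 1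
  ext u
  simp [h u (S.g i k)]

theorem exists_energy_ne (i : Fin M) (k : Fin N) :
    ∃ p q, (∀ l, l ≠ k → p l = q l) ∧ S.energy i p ≠ S.energy i q := by
  obtain ⟨u, v, huv⟩ := S.exists_level_ne i k
  refine ⟨Function.update (S.g i) k u, Function.update (S.g i) k v, fun l hl => ?_, fun h => ?_⟩
  · rw [Function.update_of_ne hl, Function.update_of_ne hl]
  · simp only [energy, ← Finset.add_sum_erase _ _ (Finset.mem_univ k), Function.update_self] at h
    refine huv (add_right_cancel (h.trans (congrArg _ ?_)))
    refine Finset.sum_congr rfl fun l hl => ?_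
    rw [Function.update_of_ne (Finset.ne_of_mem_erase hl),
      Function.update_of_ne (Finset.ne_of_mem_erase hl)]

/-- The labels are stored in the ancilla, except that `a` and `b` are distinguished only by the
energy of one particle. -/
theorem exists_injective_energy_ne (i : Fin M) (k : Fin N) {a b : ι} (hab : a ≠ b) :
    ∃ φ : ι → S.Cell (fun _ => Fintype.card ι) i, Function.Injective φ ∧
      S.energy i (φ a).1 ≠ S.energy i (φ b).1 ∧
      ∀ x y l, l ≠ k → (φ x).1 l = (φ y).1 l := by
  classical
  obtain ⟨p, q, hpq, henergy⟩ := S.exists_energy_ne i k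
  let E := Fintype.equivFin ι
  refine ⟨fun x => (if x = b then q else p, if x = b then E a else E x), fun x y hxy => ?_, ?_,
    fun x y l hl => ?_⟩
  · have hne : p ≠ q := fun h => henergy (congrArg _ h)
    grind [E.injective]
  · simpa [hab] using henergy
  · have hl := hpq l hl
    dsimp only
    split_ifs <;> simp only [hl]

variable [DecidableEq ι]

theorem objective_relabel_conj_mem_pureValues {a : Fin M → ℕ} {f : ι → S.Out a}
    (hf : Function.Injective f) (ψ : ι → ℂ) :
    S.objective a (relabel f * proj ψ * (relabel f)ᴴ) ∈ S.pureValues ψ := by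
  refine ⟨a, _, isICPTP_of_isColumnSparse (K := fun _ : Unit => relabel f) ?_
    fun _ => isColumnSparse_relabel f, ?_⟩
  · rw [Fintype.sum_unique, conjTranspose_relabel_mul_self hf]
  · rw [Fintype.sum_unique]

theorem pureCSF_pos (hM : 1 ≤ M) (hN : 1 ≤ N) {ψ : ι → ℂ} {a b : ι} (hab : a ≠ b)
    (ha : ψ a ≠ 0) (hb : ψ b ≠ 0) : 0 < S.pureCSF ψ := by
  have : Nonempty ι := ⟨a⟩
  let i : Fin M := ⟨0, hM⟩
  let k : Fin N := ⟨0, hN⟩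
  obtain ⟨φ, hφ, henergy, hagree⟩ := S.exists_injective_energy_ne i k hab
  let rest : S.Out fun _ => Fintype.card ι := fun j => (S.g j, (φ a).2)
  let f (x : ι) : S.Out fun _ => Fintype.card ι := Function.update rest i (φ x)
  have hf : Function.Injective f := (Function.update_injective _ i).comp hφ
  refine lt_of_lt_of_le ?_
    ((S.isGreatest_pureCSF ψ).2 (S.objective_relabel_conj_mem_pureValues hf ψ))
  have hfi : (f · i) = φ := funext fun x => Function.update_self _ _ _
  have hoff : ∀ x y j, j ≠ i → f x j = f y j := fun x y j hj =>
    (Function.update_of_ne hj (φ x) rest).trans (Function.update_of_ne hj (φ y) rest).symm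
  rw [S.objective_relabel_conj_of_agree hoff (posSemidef_proj ψ), hfi]
  refine S.cellValue_pos _ i ((posSemidef_proj ψ).mul_mul_conjTranspose_same _)
    (fun x y hxy l m hlm => ?_) (x := φ a) (y := φ b) ?_ henergy
  · obtain ⟨⟨u, rfl⟩, ⟨v, rfl⟩⟩ := mem_range_of_relabel_conj_apply_ne_zero hxy
    exact (hlm.ne_or_ne k).imp (hagree u v l) (hagree u v m)
  · rw [conj_proj, proj_apply, relabel_mulVec_apply hφ, relabel_mulVec_apply hφ]
    exact mul_ne_zero ha (star_ne_zero.2 hb)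

theorem isDiag_proj_of_pureCSF_eq_zero (hM : 1 ≤ M) (hN : 1 ≤ N) {ψ : ι → ℂ}
    (h : S.pureCSF ψ = 0) : (proj ψ).IsDiag := by
  intro a b hab
  by_contra hne
  exact (S.pureCSF_pos hM hN hab (left_ne_zero_of_mul hne)
    (star_ne_zero.1 (right_ne_zero_of_mul hne))).ne' h

end Setup

/-! ### The convex roof -/

section States

variable {ι κ : Type}

theorem proj_single [DecidableEq ι] (j : ι) (c : ℂ) :
    proj (Pi.single j c) = Matrix.single j j (c * star c) := by
  ext x y
  simp only [proj_apply, Matrix.single_apply, Pi.single_apply]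
  grind [star_zero]

variable [Fintype ι]

theorem IsPure.trace_proj {ψ : ι → ℂ} (hψ : IsPure ψ) : (proj ψ).trace = 1 := by
  have htrace : (proj ψ).trace = ((∑ i, ‖ψ i‖ ^ 2 : ℝ) : ℂ) := by
    simp [Matrix.trace, proj_apply, Complex.mul_conj']
  rw [htrace, hψ, Complex.ofReal_one]

theorem IsPure.nonempty {ψ : ι → ℂ} (hψ : IsPure ψ) : Nonempty ι := by
  by_contra h
  rw [not_nonempty_iff] at h
  simp [IsPure] at hψ

theorem IsState.nonempty {ρ : Matrix ι ι ℂ} (hρ : IsState ρ) : Nonempty ι := by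
  by_contra h
  rw [not_nonempty_iff] at h
  exact zero_ne_one ((Matrix.trace_eq_zero_of_isEmpty ρ).symm.trans hρ.2)

theorem isState_outcomeState [Fintype κ] {K : Matrix κ ι ℂ} {ρ : Matrix ι ι ℂ}
    (hρ : ρ.PosSemidef) (h : 0 < outcomeProb K ρ) : IsState (outcomeState K ρ) := by
  have hpos := hρ.mul_mul_conjTranspose_same K
  refine ⟨hpos.smul (inv_nonneg.2 h.le), ?_⟩
  have htrace : (K * ρ * Kᴴ).trace = (outcomeProb K ρ : ℂ) :=
    Complex.eq_re_of_ofReal_le hpos.trace_nonneg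
  rw [outcomeState, Matrix.trace_smul, htrace, Complex.real_smul, ← Complex.ofReal_mul,
    inv_mul_cancel₀ h.ne', Complex.ofReal_one]

theorem IsIncoherentKraus.isState_sum [DecidableEq ι] [Fintype κ] {r : ℕ}
    {K : Fin r → Matrix κ ι ℂ} (hK : IsIncoherentKraus K) {ρ : Matrix ι ι ℂ} (hρ : IsState ρ) :
    IsState (∑ n, K n * ρ * (K n)ᴴ) := by
  refine ⟨Matrix.posSemidef_sum _ fun n _ => hρ.1.mul_mul_conjTranspose_same (K n), ?_⟩
  calc (∑ n, K n * ρ * (K n)ᴴ).trace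
      = ((∑ n, (K n)ᴴ * K n) * ρ).trace := by
        simp only [Matrix.trace_sum, Matrix.sum_mul, Matrix.trace_mul_cycle (K _) ρ]
    _ = 1 := by rw [hK.1, Matrix.one_mul, hρ.2]

theorem IsState.convexCombination {ρ σ : Matrix ι ι ℂ} (hρ : IsState ρ) (hσ : IsState σ) {t : ℝ}
    (h0 : 0 ≤ t) (h1 : t ≤ 1) : IsState (t • ρ + (1 - t) • σ) := by
  refine ⟨(hρ.1.smul h0).add (hσ.1.smul (sub_nonneg.2 h1)), ?_⟩
  rw [Matrix.trace_add, Matrix.trace_smul, Matrix.trace_smul, hρ.2, hσ.2, ← add_smul,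
    add_sub_cancel, one_smul]

theorem conj_sum_proj {ν : Type*} [Fintype ν] (K : Matrix κ ι ℂ) (φ : ν → ι → ℂ) :
    K * (∑ m, proj (φ m)) * Kᴴ = ∑ m, proj (K *ᵥ φ m) := by
  simp only [Matrix.mul_sum, Matrix.sum_mul, conj_proj]

theorem exists_eq_sum_proj_single [DecidableEq ι] {ρ : Matrix ι ι ℂ} (hρ : ρ.PosSemidef)
    (hdiag : ρ.IsDiag) : ∃ c : ι → ℂ, ρ = ∑ j, proj (Pi.single j (c j)) := by
  choose c hc using fun j => CStarAlgebra.nonneg_iff_eq_mul_star_self.1 (hρ.diag_nonneg (i := j))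
  refine ⟨c, ?_⟩
  simp only [proj_single, ← hc, Matrix.sum_single_eq_diagonal]
  exact hdiag.diagonal_diag.symm

end States

namespace Setup

variable {M N : ℕ} (S : Setup M N) {ι : Type} [Fintype ι] [DecidableEq ι]

theorem roofValues_eq_decompositionValues (ρ : Matrix ι ι ℂ) :
    S.roofValues ρ = decompositionValues {ψ | IsPure ψ} proj S.pureCSF ρ := by
  ext v
  simp only [roofValues, decompositionValues, decompositions, average, Set.mem_ofPred_eq,
    Prod.exists, and_assoc]

theorem sum_pureCSF_mem_roofValues {ν : Type*} [Fintype ν] {φ : ν → ι → ℂ}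
    (h : IsState (∑ m, proj (φ m))) :
    ∑ m, S.pureCSF (φ m) ∈ S.roofValues (∑ m, proj (φ m)) := by
  have := h.nonempty
  choose s u hu hφ using fun m => exists_isPure_smul (φ m)
  have htrace : ∑ m, ‖s m‖ ^ 2 = 1 := by
    have htrace := h.2
    simp only [hφ, proj_smul, Matrix.trace_sum, Matrix.trace_smul, (hu _).trace_proj,
      Complex.real_smul, mul_one] at htrace
    exact_mod_cast htrace
  have hmem := sum_mem_decompositionValues (s := {ψ | IsPure ψ}) proj S.pureCSF
    (fun m => sq_nonneg ‖s m‖) htrace hu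
  simpa only [hφ, pureCSF_smul, proj_smul, S.roofValues_eq_decompositionValues] using hmem

theorem exists_of_mem_roofValues {ρ : Matrix ι ι ℂ} {v : ℝ} (hv : v ∈ S.roofValues ρ) :
    ∃ (r : ℕ) (φ : Fin r → ι → ℂ), ρ = ∑ m, proj (φ m) ∧ v = ∑ m, S.pureCSF (φ m) := by
  obtain ⟨r, p, ψ, hp, -, -, rfl, rfl⟩ := hv
  exact ⟨r, fun m => (√(p m) : ℂ) • ψ m, by simp only [proj_smul, norm_ofReal_sqrt_sq (hp _)],
    by simp only [pureCSF_smul, norm_ofReal_sqrt_sq (hp _)]⟩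

theorem isLeast_CSF {ρ : Matrix ι ι ℂ} (hρ : IsState ρ) :
    IsLeast (S.roofValues ρ) (S.CSF ρ) := by
  have := hρ.nonempty
  have hcompact : IsCompact (S.roofValues ρ) :=
    S.roofValues_eq_decompositionValues ρ ▸
      isCompact_decompositionValues isCompact_setOf_isPure continuous_proj S.continuous_pureCSF ρ
  obtain ⟨m, φ, rfl⟩ := Matrix.posSemidef_iff_eq_sum_vecMulVec.1 hρ.1
  exact hcompact.isLeast_sInf ⟨_, S.sum_pureCSF_mem_roofValues hρ⟩

theorem exists_CSF_eq {ρ : Matrix ι ι ℂ} (hρ : IsState ρ) :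
    ∃ (r : ℕ) (φ : Fin r → ι → ℂ), ρ = ∑ m, proj (φ m) ∧ S.CSF ρ = ∑ m, S.pureCSF (φ m) :=
  S.exists_of_mem_roofValues (S.isLeast_CSF hρ).1

theorem CSF_le_sum {ν : Type*} [Fintype ν] {ρ : Matrix ι ι ℂ} (hρ : IsState ρ) {φ : ν → ι → ℂ}
    (h : ρ = ∑ m, proj (φ m)) : S.CSF ρ ≤ ∑ m, S.pureCSF (φ m) := by
  subst h
  exact (S.isLeast_CSF hρ).2 (S.sum_pureCSF_mem_roofValues hρ)

theorem CSF_smul_le {ν : Type*} [Fintype ν] {c : ℝ} (hc : 0 ≤ c) {φ : ν → ι → ℂ}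
    (h : IsState (c • ∑ m, proj (φ m))) :
    S.CSF (c • ∑ m, proj (φ m)) ≤ c * ∑ m, S.pureCSF (φ m) := by
  have hle := S.CSF_le_sum h (φ := fun m => (√c : ℂ) • φ m) (by
    simp only [proj_smul, norm_ofReal_sqrt_sq hc, Finset.smul_sum])
  simpa only [pureCSF_smul, norm_ofReal_sqrt_sq hc, Finset.mul_sum] using hle

/-! ### The axioms of a coherence measure -/

theorem CSF_nonneg {ρ : Matrix ι ι ℂ} (hρ : IsState ρ) : 0 ≤ S.CSF ρ := by
  have := hρ.nonempty
  obtain ⟨r, φ, -, h⟩ := S.exists_CSF_eq hρ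
  exact h ▸ Finset.sum_nonneg fun m _ => S.pureCSF_nonneg _

theorem isDiag_of_CSF_eq_zero (hM : 1 ≤ M) (hN : 1 ≤ N) {ρ : Matrix ι ι ℂ} (hρ : IsState ρ)
    (h : S.CSF ρ = 0) : ρ.IsDiag := by
  have := hρ.nonempty
  obtain ⟨r, φ, rfl, hvalue⟩ := S.exists_CSF_eq hρ
  rw [hvalue, Finset.sum_eq_zero_iff_of_nonneg fun m _ => S.pureCSF_nonneg _] at h
  exact isDiag_sum fun m hm => S.isDiag_proj_of_pureCSF_eq_zero hM hN (h m hm)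

theorem CSF_eq_zero_of_isIncoherent {ρ : Matrix ι ι ℂ} (hρ : IsIncoherent ρ) : S.CSF ρ = 0 := by
  have := hρ.1.nonempty
  obtain ⟨c, hc⟩ := exists_eq_sum_proj_single hρ.1.1 hρ.2
  refine ((S.CSF_le_sum hρ.1 hc).trans_eq ?_).antisymm (S.CSF_nonneg hρ.1)
  refine Finset.sum_eq_zero fun j _ => S.pureCSF_eq_zero_of_isDiag ?_
  rw [proj_single, ← Matrix.diagonal_single]
  exact Matrix.isDiag_diagonal _

theorem outcomeProb_mul_CSF_le [Nonempty ι] {ν : Type*} [Fintype ν] {κ : Type} [Fintype κ]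
    (K : Matrix ι κ ℂ) (φ : ν → κ → ℂ) :
    outcomeProb K (∑ m, proj (φ m)) * S.CSF (outcomeState K (∑ m, proj (φ m))) ≤
      ∑ m, S.pureCSF (K *ᵥ φ m) := by
  have hpos : (∑ m, proj (φ m)).PosSemidef := Matrix.posSemidef_sum _ fun m _ => posSemidef_proj _
  have hprob : 0 ≤ outcomeProb K (∑ m, proj (φ m)) :=
    re_trace_nonneg (hpos.mul_mul_conjTranspose_same K)
  rcases hprob.eq_or_lt with h | h
  · rw [← h, zero_mul]
    exact Finset.sum_nonneg fun m _ => S.pureCSF_nonneg _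
  · have hstate := isState_outcomeState hpos h
    rw [outcomeState, conj_sum_proj] at hstate ⊢
    rw [← le_inv_mul_iff₀ h]
    exact S.CSF_smul_le (inv_nonneg.2 h.le) hstate

variable {κ : Type} [Fintype κ] [DecidableEq κ]

theorem sum_sum_pureCSF_le [Nonempty ι] {ν : Type*} [Fintype ν] {r : ℕ} {K : Fin r → Matrix κ ι ℂ}
    (hK : IsIncoherentKraus K) (φ : ν → ι → ℂ) :
    ∑ n, ∑ m, S.pureCSF (K n *ᵥ φ m) ≤ ∑ m, S.pureCSF (φ m) := by
  rw [Finset.sum_comm]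
  exact Finset.sum_le_sum fun m _ => S.sum_pureCSF_le hK (φ m)

theorem CSF_map_le {Φ : Matrix ι ι ℂ → Matrix κ κ ℂ} (hΦ : IsICPTP Φ) {ρ : Matrix ι ι ℂ}
    (hρ : IsState ρ) : S.CSF (Φ ρ) ≤ S.CSF ρ := by
  have := hρ.nonempty
  obtain ⟨r, K, hK, hΦK⟩ := hΦ
  have hstate := hK.isState_sum hρ
  obtain ⟨q, φ, rfl, hvalue⟩ := S.exists_CSF_eq hρ
  rw [hΦK, hvalue]
  calc S.CSF (∑ n, K n * (∑ m, proj (φ m)) * (K n)ᴴ)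
      ≤ ∑ x : Fin r × Fin q, S.pureCSF (K x.1 *ᵥ φ x.2) :=
        S.CSF_le_sum hstate (by simp only [conj_sum_proj, Fintype.sum_prod_type])
    _ = ∑ n, ∑ m, S.pureCSF (K n *ᵥ φ m) := Fintype.sum_prod_type _
    _ ≤ ∑ m, S.pureCSF (φ m) := S.sum_sum_pureCSF_le hK φ

theorem sum_outcomeProb_mul_CSF_le {r : ℕ} {K : Fin r → Matrix κ ι ℂ} (hK : IsIncoherentKraus K)
    {ρ : Matrix ι ι ℂ} (hρ : IsState ρ) :
    ∑ n, outcomeProb (K n) ρ * S.CSF (outcomeState (K n) ρ) ≤ S.CSF ρ := by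
  have := hρ.nonempty
  have := hK.nonempty
  obtain ⟨q, φ, rfl, hvalue⟩ := S.exists_CSF_eq hρ
  rw [hvalue]
  exact (Finset.sum_le_sum fun n _ => S.outcomeProb_mul_CSF_le (K n) φ).trans
    (S.sum_sum_pureCSF_le hK φ)

theorem CSF_convex {ρ σ : Matrix ι ι ℂ} (hρ : IsState ρ) (hσ : IsState σ) {t : ℝ} (h0 : 0 ≤ t)
    (h1 : t ≤ 1) : S.CSF (t • ρ + (1 - t) • σ) ≤ t * S.CSF ρ + (1 - t) * S.CSF σ := by
  have hstate := hρ.convexCombination hσ h0 h1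
  have h1' : 0 ≤ 1 - t := sub_nonneg.2 h1
  obtain ⟨q, φ, rfl, hvalue⟩ := S.exists_CSF_eq hρ
  obtain ⟨q', χ, rfl, hvalue'⟩ := S.exists_CSF_eq hσ
  rw [hvalue, hvalue']
  have hle := S.CSF_le_sum hstate
    (φ := Sum.elim (fun m => (√t : ℂ) • φ m) fun m => (√(1 - t) : ℂ) • χ m) (by
      simp only [Fintype.sum_sum_type, Sum.elim_inl, Sum.elim_inr, proj_smul,
        norm_ofReal_sqrt_sq h0, norm_ofReal_sqrt_sq h1', Finset.smul_sum])
  simpa only [Fintype.sum_sum_type, Sum.elim_inl, Sum.elim_inr, pureCSF_smul,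
    norm_ofReal_sqrt_sq h0, norm_ofReal_sqrt_sq h1', Finset.mul_sum] using hle

theorem isCoherenceMeasure_CSF (hM : 1 ≤ M) (hN : 1 ≤ N) :
    IsCoherenceMeasure (fun (ι : Type) [Fintype ι] [DecidableEq ι] => S.CSF (ι := ι)) where
  nonneg _ _ _ _ hρ := S.CSF_nonneg hρ
  eq_zero_iff _ _ _ _ hρ :=
    ⟨fun h => ⟨hρ, S.isDiag_of_CSF_eq_zero hM hN hρ h⟩, S.CSF_eq_zero_of_isIncoherent⟩
  monotone _ _ _ _ _ _ _ hΦ _ hρ := S.CSF_map_le hΦ hρ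
  strong_monotone _ _ _ _ _ _ _ _ hK _ hρ := S.sum_outcomeProb_mul_CSF_le hK hρ
  convex _ _ _ _ _ hρ hσ _ h0 h1 := S.CSF_convex hρ hσ h0 h1

end Setup

end SFCoherence

end

theorem theorem4 (M N : ℕ) (hM : 1 ≤ M) (hN : 1 ≤ N) (S : SFCoherence.Setup M N) :
    -- the maximum over incoherent operations exists
    (∀ (ι : Type) [Fintype ι] [DecidableEq ι] (ψ : ι → ℂ), SFCoherence.IsPure ψ →
      IsGreatest (S.pureValues ψ) (S.pureCSF ψ)) ∧
    -- the minimum over pure state decompositions exists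
    (∀ (ι : Type) [Fintype ι] [DecidableEq ι] (ρ : Matrix ι ι ℂ), SFCoherence.IsState ρ →
      IsLeast (S.roofValues ρ) (S.CSF ρ)) ∧
    SFCoherence.IsCoherenceMeasure (fun (ι : Type) [Fintype ι] [DecidableEq ι] => S.CSF (ι := ι)) := by
  exact ⟨fun _ _ _ _ hψ => have := hψ.nonempty; S.isGreatest_pureCSF _,
    fun _ _ _ _ hρ => S.isLeast_CSF hρ, S.isCoherenceMeasure_CSF hM hN⟩
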